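/- Let $\mathcal X,\mathcal Y,\mathcal Z$ be finite sets, $q_X$ a probability mass function on $\mathcal X$ and $q_{YZ|X}$ a broadcast channel. All information quantities are in bits. A simulation code of blocklength $n\ge 1$ and rates $R,R_1,R_2\ge 0$ consists of a stochastic encoder that maps $(X^n,\Theta_1,\Theta_2)$ to a message $M\in[2^{nR}]$, a stochastic decoder that maps $(M,\Theta_1)$ to $Y^n$, and a stochastic decoder that maps $(M,\Theta_2)$ to $Z^n$ (the three use independent private randomness). Here $X^n$ is i.i.d. $q_X$, $\Theta_1$ is uniform on $[2^{nR_1}]$, $\Theta_2$ is uniform on $[2^{nR_2}]$, the variables $X^n,\Theta_1,\Theta_2$ are independent, and $[2^{a}]=\{1,\dots,\lfloor 2^{a}\rfloor\}$. The triple $(R,R_1,R_2)$ is achievable if for every $\varepsilon>0$ there are $n\ge1$ and a code of blocklength $n$ with these rates such that the law of $(X^n,Y^n,Z^n)$ is within total variation distance $\varepsilon$ of $\prod_{i=1}^n q_X(x_i)\,q_{YZ|X}(y_i,z_i|x_i)$. Let $R_{\mathrm{opt}}$ be the infimum of all $R$ such that $(R,R_1,R_2)$ is achievable for some $R_1,R_2\ge0$.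 Theorem. We have $$R_{\mathrm{opt}}\ \ge\ \min_{p_{U|XYZ}}\max\Big\{I(Y;Z|U)+I(U,Y,Z;X),\ \tfrac12\big[I(Y;Z|U)+I(U,Y,Z;X)+I(U;X,Y,Z)\big]\Big\},$$ where the minimum is over all conditional laws $p_{U|XYZ}$ of a random variable $U$ with an arbitrary finite alphabet, the information quantities are computed for $(U,X,Y,Z)\sim q_X\,q_{YZ|X}\,p_{U|XYZ}$, and the minimum is attained. Moreover, the minimum $$\min_{p_{U|XYZ}}\max\big\{I(Y;Z|U)+I(U,Y,Z;X),\ I(U;X,Y,Z)\big\}$$ is attained as well and has the same value, so that it gives an equivalent form of the lower bound. -/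

import Mathlib

namespace BroadcastSim

/-! Probability mass functions on a finite type `α` are the elements of `stdSimplex ℝ α`.
All information quantities are in bits. -/

section Information

variable {Ω α β γ : Type*} [Fintype Ω] [Fintype α] [Fintype β] [Fintype γ]

open scoped Classical in
/-- The probability mass function of the random variable `f` on the finite probability space
`(Ω, p)`. -/
noncomputable def law (p : Ω → ℝ) (f : Ω → α) (a : α) : ℝ :=
  ∑ ω, if f ω = a then p ω else 0

/-- Shannon entropy `H(f) = -∑ₐ P(f = a) log₂ P(f = a)`. -/
noncomputable def entropy (p : Ω → ℝ) (f : Ω → α) : ℝ :=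
  ∑ a, -(law p f a * Real.logb 2 (law p f a))

/-- Conditional entropy `H(f | g) = H(f, g) - H(g)`. -/
noncomputable def condEntropy (p : Ω → ℝ) (f : Ω → α) (g : Ω → β) : ℝ :=
  entropy p (fun ω => (f ω, g ω)) - entropy p g

/-- Mutual information `I(f; g) = H(f) - H(f | g)`. -/
noncomputable def mutualInfo (p : Ω → ℝ) (f : Ω → α) (g : Ω → β) : ℝ :=
  entropy p f - condEntropy p f g

/-- Conditional mutual information `I(f; g | h) = H(f | h) - H(f | g, h)`. -/
noncomputable def condMutualInfo (p : Ω → ℝ) (f : Ω → α) (g : Ω → β) (h : Ω → γ) : ℝ :=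
  condEntropy p f h - condEntropy p f (fun ω => (g ω, h ω))

end Information

/-- Total variation distance of two probability mass functions on a finite type. -/
noncomputable def tvDist {Ω : Type*} [Fintype Ω] (p q : Ω → ℝ) : ℝ :=
  (1 / 2) * ∑ ω, |p ω - q ω|

/-- A simulation code of blocklength `n` with `m` messages, and `k₁`, `k₂` values of the
randomness that the encoder shares with the first and with the second receiver.  The encoder and
both decoders may use private randomness: they are stochastic maps.  Both receivers get the same
message; each sees only its own shared randomness. -/
structure Code (X Y Z : Type*) [Fintype X] [Fintype Y] [Fintype Z] (n m k₁ k₂ : ℕ) where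
  enc : (Fin n → X) → Fin k₁ → Fin k₂ → Fin m → ℝ
  enc_mem : ∀ x a b, enc x a b ∈ stdSimplex ℝ (Fin m)
  dec₁ : Fin m → Fin k₁ → (Fin n → Y) → ℝ
  dec₁_mem : ∀ c a, dec₁ c a ∈ stdSimplex ℝ (Fin n → Y)
  dec₂ : Fin m → Fin k₂ → (Fin n → Z) → ℝ
  dec₂_mem : ∀ c b, dec₂ c b ∈ stdSimplex ℝ (Fin n → Z)

section Simulation

variable {X Y Z : Type*} [Fintype X] [Fintype Y] [Fintype Z]

/-- The law of `(Xⁿ, Yⁿ, Zⁿ)` produced by a code when `Xⁿ` is i.i.d. `qX` and the two shared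
random variables are uniform, independent of each other and of `Xⁿ`. -/
noncomputable def Code.inducedLaw {n m k₁ k₂ : ℕ} (C : Code X Y Z n m k₁ k₂) (qX : X → ℝ) :
    (Fin n → X) × (Fin n → Y) × (Fin n → Z) → ℝ :=
  fun t => (∏ i, qX (t.1 i)) *
    ∑ a : Fin k₁, ∑ b : Fin k₂, (1 / (k₁ : ℝ)) * (1 / (k₂ : ℝ)) *
      ∑ c : Fin m, C.enc t.1 a b c * C.dec₁ c a t.2.1 * C.dec₂ c b t.2.2

/-- The law of `(Xⁿ, Yⁿ, Zⁿ)` when `Xⁿ` is i.i.d. `qX` and is passed through `n` independent uses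
of the broadcast channel `W`, where `W x (y, z)` is the probability of the outputs `(y, z)` given
the input `x`. -/
noncomputable def targetLaw (n : ℕ) (qX : X → ℝ) (W : X → Y × Z → ℝ) :
    (Fin n → X) × (Fin n → Y) × (Fin n → Z) → ℝ :=
  fun t => ∏ i, qX (t.1 i) * W (t.1 i) (t.2.1 i, t.2.2 i)

/-- `(R, R₁, R₂)` is achievable: with message alphabet `[2^{nR}]` and shared randomness alphabets
`[2^{nR₁}]`, `[2^{nR₂}]`, the channel can be simulated to any accuracy in total variation. -/
def Achievable (qX : X → ℝ) (W : X → Y × Z → ℝ) (R R₁ R₂ : ℝ) : Prop :=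
  0 ≤ R ∧ 0 ≤ R₁ ∧ 0 ≤ R₂ ∧
    ∀ ε : ℝ, 0 < ε → ∃ n : ℕ, 1 ≤ n ∧
      ∃ C : Code X Y Z n ⌊(2 : ℝ) ^ ((n : ℝ) * R)⌋₊ ⌊(2 : ℝ) ^ ((n : ℝ) * R₁)⌋₊
          ⌊(2 : ℝ) ^ ((n : ℝ) * R₂)⌋₊,
        tvDist (C.inducedLaw qX) (targetLaw n qX W) < ε

/-- The optimal communication rate, when the rates of shared randomness are unlimited. -/
noncomputable def Ropt (qX : X → ℝ) (W : X → Y × Z → ℝ) : ℝ :=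
  sInf {R : ℝ | ∃ R₁ R₂ : ℝ, Achievable qX W R R₁ R₂}

/-- Conditional probability mass functions `p_{U|XYZ}`, where `U` takes values in `Fin k`. -/
def auxChannels (X Y Z : Type*) (k : ℕ) : Set (X × Y × Z → Fin k → ℝ) :=
  {pU | ∀ t, pU t ∈ stdSimplex ℝ (Fin k)}

/-- The joint law `q_X(x) W(y, z | x) p_{U|XYZ}(u | x, y, z)` of `(U, X, Y, Z)`. -/
def jointLaw {k : ℕ} (qX : X → ℝ) (W : X → Y × Z → ℝ) (pU : X × Y × Z → Fin k → ℝ) :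
    Fin k × X × Y × Z → ℝ :=
  fun (u, x, y, z) => qX x * W x (y, z) * pU (x, y, z) u

/-- `I(Y; Z | U) + I(U, Y, Z; X)`. -/
noncomputable def infoSum {k : ℕ} (qX : X → ℝ) (W : X → Y × Z → ℝ)
    (pU : X × Y × Z → Fin k → ℝ) : ℝ :=
  condMutualInfo (jointLaw qX W pU) (fun (_, _, y, _) => y) (fun (_, _, _, z) => z)
      (fun (u, _, _, _) => u) +
    mutualInfo (jointLaw qX W pU) (fun (u, _, y, z) => (u, y, z)) (fun (_, x, _, _) => x)

/-- `I(U; X, Y, Z)`. -/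
noncomputable def infoAux {k : ℕ} (qX : X → ℝ) (W : X → Y × Z → ℝ)
    (pU : X × Y × Z → Fin k → ℝ) : ℝ :=
  mutualInfo (jointLaw qX W pU) (fun (u, _, _, _) => u) (fun (_, x, y, z) => (x, y, z))

end Simulation

end BroadcastSim

/-! Write V = (X, Y, Z). By the chain rule, I(Y;Z|U) + I(U,Y,Z;X) = H(X) + [H(Y|U) + H(Z|U) -
H(V|U)] and I(U;V) = H(V) - H(V|U). Conditional entropies are averages over the values of U, so the
law of V, the bracket and H(V|U) together range over the convex hull of the points given by single
laws. This hull, `entropyRegion`, is compact and convex and covers every finite alphabet of U. The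
set `attainablePairs` of pairs of information quantities is an affine image of the slice of this
hull over the channel law; its compactness makes both minima attained.

Converse. In a code, the first output depends on the rest only through (M, Θ₁), the second only
through (M, Θ₂), and Xⁿ, Θ₁, Θ₂ are independent. Shannon inequalities then give I(Yⁿ;Zⁿ|M) +
I(M,Yⁿ,Zⁿ;Xⁿ) ≤ H(M) ≤ nR (`codePMF_infoSum_le`), while I(M;Vⁿ) ≤ H(M) always holds. Taking U_i =
(M, V₁, …, V_{i-1}) and averaging over i turns these into bounds on one point of `entropyRegion`
(`exists_mem_entropyRegion`). Its law is only close to the channel law; Fannes' inequality controls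
the loss in H(Vⁿ), and compactness yields a limit point exactly over the channel law as the error
vanishes. Hence some attainable pair has both coordinates at most R (`Achievable.exists_le`).

The two minima agree by convexity: if the second coordinate of an optimal pair exceeds the first,
mixing with the pair of a constant U balances them at half their sum
(`exists_isLeast_attainablePairs`). -/

namespace BroadcastSim

/-! ### Entropy inequalities on a finite probability space. -/

section Entropy

set_option linter.unusedSectionVars false

variable {Ω α β γ : Type*} [Fintype Ω] [Fintype α] [Fintype β] [Fintype γ]

/-- The function `x ↦ -x log₂ x`. -/
noncomputable def negMulLogb (x : ℝ) : ℝ := -(x * Real.logb 2 x)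

lemma negMulLogb_eq (x : ℝ) : negMulLogb x = Real.negMulLog x / Real.log 2 := by
  simp only [negMulLogb, Real.negMulLog, Real.logb]
  ring

lemma continuous_negMulLogb : Continuous negMulLogb := by
  rw [funext negMulLogb_eq]
  fun_prop

@[simp] lemma negMulLogb_zero : negMulLogb 0 = 0 := by simp [negMulLogb]

@[simp] lemma negMulLogb_one : negMulLogb 1 = 0 := by simp [negMulLogb]

lemma negMulLogb_mul (x y : ℝ) :
    negMulLogb (x * y) = y * negMulLogb x + x * negMulLogb y := by
  simp only [negMulLogb_eq, Real.negMulLog_mul]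
  ring

lemma negMulLogb_nonneg {x : ℝ} (h0 : 0 ≤ x) (h1 : x ≤ 1) : 0 ≤ negMulLogb x := by
  rw [negMulLogb_eq]
  exact div_nonneg (Real.negMulLog_nonneg h0 h1) (Real.log_nonneg one_le_two)

lemma entropy_def (p : Ω → ℝ) (f : Ω → α) : entropy p f = ∑ a, negMulLogb (law p f a) := rfl

lemma law_apply [DecidableEq α] (p : Ω → ℝ) (f : Ω → α) (a : α) :
    law p f a = ∑ ω, if f ω = a then p ω else 0 := by
  refine Finset.sum_congr rfl fun ω _ => ?_
  split_ifs <;> rfl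

lemma law_nonneg {p : Ω → ℝ} (hp : ∀ ω, 0 ≤ p ω) (f : Ω → α) (a : α) : 0 ≤ law p f a :=
  Finset.sum_nonneg fun ω _ => by split_ifs <;> simp [hp]

lemma sum_law_mul (p : Ω → ℝ) (f : Ω → α) (g : α → ℝ) :
    ∑ a, law p f a * g a = ∑ ω, p ω * g (f ω) := by
  classical
  simp only [law_apply, Finset.sum_mul, ite_mul, zero_mul]
  rw [Finset.sum_comm]
  simp

lemma sum_law (p : Ω → ℝ) (f : Ω → α) : ∑ a, law p f a = ∑ ω, p ω := by
  simpa using sum_law_mul p f 1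

lemma law_mem {p : Ω → ℝ} (hp : p ∈ stdSimplex ℝ Ω) (f : Ω → α) :
    law p f ∈ stdSimplex ℝ α :=
  ⟨law_nonneg hp.1 f, (sum_law p f).trans hp.2⟩

lemma law_law (p : Ω → ℝ) (f : Ω → α) (g : α → β) :
    law (law p f) g = law p (fun ω => g (f ω)) := by
  classical
  ext b
  simpa [law_apply] using sum_law_mul p f (fun a => if g a = b then 1 else 0)

lemma entropy_law (p : Ω → ℝ) (f : Ω → α) (g : α → β) :
    entropy (law p f) g = entropy p (fun ω => g (f ω)) := by
  rw [entropy, law_law, entropy]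

lemma law_id (p : Ω → ℝ) : law p (fun ω => ω) = p := by
  classical
  ext a
  simp [law_apply]

lemma law_fst {p : Ω → ℝ} (f : Ω → α) (g : Ω → β) (a : α) :
    law p f a = ∑ b, law p (fun ω => (f ω, g ω)) (a, b) := by
  classical
  simp only [law_apply, Prod.mk.injEq]
  rw [Finset.sum_comm]
  refine Finset.sum_congr rfl fun ω _ => ?_
  by_cases h : f ω = a <;> simp [h]

lemma law_snd {p : Ω → ℝ} (f : Ω → α) (g : Ω → β) (b : β) :
    law p g b = ∑ a, law p (fun ω => (f ω, g ω)) (a, b) := by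
  classical
  simp only [law_apply, Prod.mk.injEq]
  rw [Finset.sum_comm]
  refine Finset.sum_congr rfl fun ω _ => ?_
  by_cases h : g ω = b <;> simp [h]

lemma le_law {p : Ω → ℝ} (hp : ∀ ω, 0 ≤ p ω) (f : Ω → α) (ω : Ω) : p ω ≤ law p f (f ω) := by
  classical
  refine le_trans ?_ (Finset.single_le_sum (f := fun ω' => if f ω' = f ω then p ω' else 0)
    (fun ω' _ => ?_) (Finset.mem_univ ω))
  · simp
  · split_ifs <;> simp [hp]

/-- Entropy as an expectation over `Ω`: entropies of variables with different alphabets become sums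
over one index set and can be compared term by term. -/
lemma entropy_eq_sum (p : Ω → ℝ) (f : Ω → α) :
    entropy p f = ∑ ω, p ω * -Real.logb 2 (law p f (f ω)) := by
  rw [← sum_law_mul p f (fun a => -Real.logb 2 (law p f a))]
  simp [entropy]

/-- The entropy of a random variable depends only on the partition that it induces. -/
lemma entropy_congr (p : Ω → ℝ) {f : Ω → α} {g : Ω → β}
    (h : ∀ ω ω', f ω = f ω' ↔ g ω = g ω') : entropy p f = entropy p g := by
  classical
  simp only [entropy_eq_sum, law_apply, h]

lemma entropy_mono {p : Ω → ℝ} (hp : ∀ ω, 0 ≤ p ω) {f : Ω → α} {g : Ω → β}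
    (h : ∀ ω ω', g ω = g ω' → f ω = f ω') : entropy p f ≤ entropy p g := by
  classical
  simp only [entropy_eq_sum]
  refine Finset.sum_le_sum fun ω _ => ?_
  rcases (hp ω).eq_or_lt with h0 | h0
  · simp [← h0]
  refine mul_le_mul_of_nonneg_left (neg_le_neg ?_) h0.le
  refine Real.logb_le_logb_of_le one_lt_two (h0.trans_le (le_law hp g ω)) ?_
  refine Finset.sum_le_sum fun ω' _ => ?_
  by_cases hg : g ω' = g ω
  · simp [hg, h _ _ hg]
  · simp only [hg, if_false]
    split_ifs <;> simp [hp]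

/-- Strong subadditivity of entropy, which says that `I(f; g | h) ≥ 0`. -/
lemma entropy_submodular {p : Ω → ℝ} (hp : ∀ ω, 0 ≤ p ω) (f : Ω → α) (g : Ω → β) (h : Ω → γ) :
    entropy p (fun ω => (f ω, g ω, h ω)) + entropy p h ≤
      entropy p (fun ω => (f ω, h ω)) + entropy p (fun ω => (g ω, h ω)) := by
  classical
  set F := law p (fun ω => (f ω, g ω, h ω)) with hF
  set A := law p (fun ω => (f ω, h ω)) with hA
  set B := law p (fun ω => (g ω, h ω)) with hB
  set C := law p h with hC
  -- The expected likelihood ratio of the conditionally independent law to the true law is at most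
  -- 1. Combined with log x ≤ x - 1, applied pointwise below, this gives the claim.
  have key : ∑ ω, p ω * (A (f ω, h ω) * B (g ω, h ω) / (F (f ω, g ω, h ω) * C (h ω)))
      ≤ ∑ ω, p ω := by
    rw [← sum_law_mul p (fun ω => (f ω, g ω, h ω))
      (fun t => A (t.1, t.2.2) * B (t.2.1, t.2.2) / (F t * C t.2.2)), ← hF, ← sum_law p h]
    have hle : ∀ t : α × β × γ, F t * (A (t.1, t.2.2) * B (t.2.1, t.2.2) / (F t * C t.2.2)) ≤
        A (t.1, t.2.2) * B (t.2.1, t.2.2) / C t.2.2 := by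
      intro t
      have h1 : 0 ≤ A (t.1, t.2.2) * B (t.2.1, t.2.2) / C t.2.2 :=
        div_nonneg (mul_nonneg (law_nonneg hp _ _) (law_nonneg hp _ _)) (law_nonneg hp _ _)
      by_cases h0 : F t = 0
      · simpa [h0] using h1
      · apply le_of_eq
        rw [mul_div_assoc', mul_div_mul_left _ _ h0]
    refine (Finset.sum_le_sum fun t _ => hle t).trans ?_
    have h2 : ∀ c, ∑ a, ∑ b, A (a, c) * B (b, c) / C c = C c := by
      intro c
      simp only [← Finset.sum_div, ← Finset.mul_sum, ← Finset.sum_mul]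
      rw [hA, hB, ← law_snd f h, ← law_snd g h]
      exact mul_self_div_self _
    simp only [Fintype.sum_prod_type]
    rw [Finset.sum_congr rfl fun a _ => Finset.sum_comm, Finset.sum_comm]
    exact le_of_eq (Finset.sum_congr rfl fun c _ => h2 c)
  simp only [entropy_eq_sum]
  rw [← sub_nonneg, ← Finset.sum_add_distrib, ← Finset.sum_add_distrib, ← Finset.sum_sub_distrib]
  have hlog : 0 < Real.log 2 := Real.log_pos one_lt_two
  rw [← sub_nonneg, ← Finset.sum_sub_distrib] at key
  refine le_trans (div_nonneg key hlog.le) ?_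
  rw [Finset.sum_div]
  refine Finset.sum_le_sum fun ω _ => ?_
  rcases (hp ω).eq_or_lt with h0 | h0
  · simp [← h0]
  have hF0 := h0.trans_le (le_law hp (fun ω => (f ω, g ω, h ω)) ω)
  have hA0 := h0.trans_le (le_law hp (fun ω => (f ω, h ω)) ω)
  have hB0 := h0.trans_le (le_law hp (fun ω => (g ω, h ω)) ω)
  have hC0 := h0.trans_le (le_law hp h ω)
  rw [← hF] at hF0
  rw [← hA] at hA0
  rw [← hB] at hB0
  rw [← hC] at hC0
  have hl := Real.log_le_sub_one_of_pos (div_pos (mul_pos hA0 hB0) (mul_pos hF0 hC0))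
  rw [Real.log_div (mul_pos hA0 hB0).ne' (mul_pos hF0 hC0).ne', Real.log_mul hA0.ne' hB0.ne',
    Real.log_mul hF0.ne' hC0.ne'] at hl
  rw [div_le_iff₀ hlog]
  simp only [Real.logb]
  have h3 := mul_le_mul_of_nonneg_left hl h0.le
  field_simp at h3 ⊢
  linarith

/-- If the conditional law of `g` given `f` depends only on `h ∘ f`, then
`H(g | f) = H(g | h ∘ f)`. -/
lemma entropy_of_factor {p : Ω → ℝ} (hp : ∀ ω, 0 ≤ p ω) (f : Ω → α) (g : Ω → β) (h : α → γ) (κ : γ → β → ℝ)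
    (hκ : ∀ a b, law p (fun ω => (f ω, g ω)) (a, b) = law p f a * κ (h a) b) :
    entropy p (fun ω => (f ω, g ω)) + entropy p (fun ω => h (f ω)) =
      entropy p f + entropy p (fun ω => (h (f ω), g ω)) := by
  classical
  have h2 : ∀ c b, law p (fun ω => (h (f ω), g ω)) (c, b) =
      law p (fun ω => h (f ω)) c * κ c b := by
    intro c b
    have e1 := congrFun (law_law p (fun ω => (f ω, g ω)) (fun t => (h t.1, t.2))) (c, b)
    have e2 := congrFun (law_law p f h) c
    rw [← e1, ← e2]
    rw [law_apply, law_apply, Fintype.sum_prod_type, Finset.sum_mul]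
    refine Finset.sum_congr rfl fun a _ => ?_
    by_cases hc : h a = c
    · simp [hc, hκ]
    · simp [hc]
  have e3 := sum_law_mul p (fun ω => (f ω, g ω))
    (fun t => -Real.logb 2 (law p (fun ω => (f ω, g ω)) t) +
      -Real.logb 2 (law p (fun ω => h (f ω)) (h t.1)))
  have e4 := sum_law_mul p (fun ω => (f ω, g ω))
    (fun t => -Real.logb 2 (law p f t.1) +
      -Real.logb 2 (law p (fun ω => (h (f ω), g ω)) (h t.1, t.2)))
  simp only [entropy_eq_sum, ← Finset.sum_add_distrib, ← mul_add]
  rw [← e3, ← e4]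
  refine Finset.sum_congr rfl fun ⟨a, b⟩ _ => ?_
  -- On the support the kernel factor contributes the same log κ to both sides and cancels.
  simp only [hκ, h2]
  by_cases h0 : law p f a * κ (h a) b = 0
  · simp [h0]
  · have hf0 := left_ne_zero_of_mul h0
    have hk0 := right_ne_zero_of_mul h0
    have hh : law p (fun ω => h (f ω)) (h a) ≠ 0 := by
      have h3 := le_law (law_nonneg hp f) h a
      rw [law_law] at h3
      exact (((law_nonneg hp f a).lt_of_ne' hf0).trans_le h3).ne'
    rw [Real.logb_mul hf0 hk0, Real.logb_mul hh hk0]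
    ring

lemma entropy_const {p : Ω → ℝ} (hp : p ∈ stdSimplex ℝ Ω) (c : α) :
    entropy p (fun _ => c) = 0 := by
  classical
  simp [entropy_eq_sum, law_apply, hp.2]

lemma entropy_pair_le {p : Ω → ℝ} (hp : p ∈ stdSimplex ℝ Ω) (f : Ω → α) (g : Ω → β) :
    entropy p (fun ω => (f ω, g ω)) ≤ entropy p f + entropy p g := by
  have h := entropy_submodular hp.1 f g (fun _ => ())
  rw [entropy_const hp, add_zero] at h
  have e1 : entropy p (fun ω => (f ω, g ω, ())) = entropy p (fun ω => (f ω, g ω)) :=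
    entropy_congr p (by simp)
  have e2 : entropy p (fun ω => (f ω, ())) = entropy p f := entropy_congr p (by simp)
  have e3 : entropy p (fun ω => (g ω, ())) = entropy p g := entropy_congr p (by simp)
  rwa [e1, e2, e3] at h

lemma entropy_pair_of_indep {p : Ω → ℝ} (hp : p ∈ stdSimplex ℝ Ω) (f : Ω → α) (g : Ω → β)
    (κ : β → ℝ) (hκ : ∀ a b, law p (fun ω => (f ω, g ω)) (a, b) = law p f a * κ b) :
    entropy p (fun ω => (f ω, g ω)) = entropy p f + entropy p g := by
  have h := entropy_of_factor hp.1 f g (fun _ => ()) (fun _ => κ) hκ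
  rw [entropy_const hp, add_zero] at h
  have e : entropy p (fun ω => ((), g ω)) = entropy p g := entropy_congr p (by simp)
  rwa [e] at h

end Entropy

/-! ### Continuity of entropy in total variation, and entropy of i.i.d. words. -/

section Bounds

variable {Ω α β : Type*} [Fintype Ω] [Fintype α] [Fintype β]

/-- Jensen's inequality with uniform weights. The total mass is left free because the bound is also
needed for the leftover mass in Fannes' inequality. -/
lemma sum_negMulLogb_le [Nonempty α] {r : α → ℝ} (hr : ∀ a, 0 ≤ r a) :
    ∑ a, negMulLogb (r a) ≤
      negMulLogb (∑ a, r a) + (∑ a, r a) * Real.logb 2 (Fintype.card α) := by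
  have hN : (0 : ℝ) < Fintype.card α := by exact_mod_cast Fintype.card_pos
  have h := Real.concaveOn_negMulLog.le_map_sum (t := Finset.univ)
    (w := fun _ : α => (Fintype.card α : ℝ)⁻¹) (p := r) (fun _ _ => by positivity)
    (by simp [hN.ne']) (fun a _ => hr a)
  simp only [smul_eq_mul, ← Finset.mul_sum] at h
  rw [Real.negMulLog_mul] at h
  simp only [negMulLogb_eq, Real.logb, ← Finset.sum_div, ← mul_div_assoc, ← add_div]
  refine div_le_div_of_nonneg_right ?_ (Real.log_nonneg one_le_two)
  have h2 := mul_le_mul_of_nonneg_left h hN.le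
  have h3 : Real.negMulLog (Fintype.card α : ℝ)⁻¹ =
      (Fintype.card α : ℝ)⁻¹ * Real.log (Fintype.card α) := by
    rw [Real.negMulLog, Real.log_inv]
    ring
  rw [h3, mul_inv_cancel_left₀ hN.ne'] at h2
  refine h2.trans (le_of_eq ?_)
  field_simp
  ring

lemma entropy_le_logb_card [Nonempty α] {p : Ω → ℝ} (hp : p ∈ stdSimplex ℝ Ω) (f : Ω → α) :
    entropy p f ≤ Real.logb 2 (Fintype.card α) := by
  have h := sum_negMulLogb_le (law_mem hp f).1
  rw [(law_mem hp f).2] at h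
  simpa [entropy_def] using h

lemma sum_negMulLogb_add_bounds {m s : α → ℝ} (hm : ∀ a, 0 ≤ m a) (hs : ∀ a, 0 ≤ s a)
    (h1 : ∑ a, m a + ∑ a, s a = 1) :
    ∑ a, negMulLogb (m a + s a) ≤ ∑ a, negMulLogb (m a) + ∑ a, negMulLogb (s a) ∧
      ∑ a, negMulLogb (m a) + ∑ a, negMulLogb (s a) ≤
        ∑ a, negMulLogb (m a + s a) + (negMulLogb (∑ a, m a) + negMulLogb (∑ a, s a)) := by
  classical
  -- A Boolean label T records which of the two parts a point comes from; the bounds are H(A) ≤ H(T,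
  -- A) ≤ H(T) + H(A).
  let p : Bool × α → ℝ := fun t => if t.1 then m t.2 else s t.2
  have hp : p ∈ stdSimplex ℝ (Bool × α) := by
    refine ⟨fun t => ?_, ?_⟩
    · simp only [p]
      split_ifs <;> simp [hm, hs]
    · simpa [p, Fintype.sum_prod_type] using h1
  have e1 : entropy p (fun t => (t.1, t.2)) = ∑ a, negMulLogb (m a) + ∑ a, negMulLogb (s a) := by
    have : law p (fun t => (t.1, t.2)) = p := law_id p
    rw [entropy_def, this]
    simp [p, Fintype.sum_prod_type]
  have e2 : entropy p Prod.snd = ∑ a, negMulLogb (m a + s a) := by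
    rw [entropy_def]
    refine Finset.sum_congr rfl fun a _ => ?_
    simp [law_apply, p, Fintype.sum_prod_type]
  have e3 : entropy p Prod.fst = negMulLogb (∑ a, m a) + negMulLogb (∑ a, s a) := by
    simp [entropy_def, law_apply, p, Fintype.sum_prod_type]
  rw [← e1, ← e2, ← e3]
  refine ⟨entropy_mono hp.1 fun t t' h => (Prod.mk.inj h).2, ?_⟩
  have h := entropy_pair_le hp Prod.fst Prod.snd
  linarith

/-- The modulus of continuity of the entropy with respect to the total variation distance. -/
noncomputable def entropyModulus (δ : ℝ) : ℝ := negMulLogb (1 - δ) + 2 * negMulLogb δ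

lemma continuous_entropyModulus : Continuous entropyModulus := by
  have := continuous_negMulLogb
  unfold entropyModulus
  fun_prop

lemma tvDist_nonneg (P Q : α → ℝ) : 0 ≤ tvDist P Q :=
  mul_nonneg (by norm_num) (Finset.sum_nonneg fun _ _ => abs_nonneg _)

lemma sum_min_eq {P Q : α → ℝ} (hP : P ∈ stdSimplex ℝ α) (hQ : Q ∈ stdSimplex ℝ α) :
    ∑ a, min (P a) (Q a) = 1 - tvDist P Q := by
  have h : ∀ a, min (P a) (Q a) = (1 / 2) * (P a + Q a - |P a - Q a|) := by
    intro a
    rcases le_total (P a) (Q a) with h | h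
    · rw [min_eq_left h, abs_of_nonpos (sub_nonpos.2 h)]
      ring
    · rw [min_eq_right h, abs_of_nonneg (sub_nonneg.2 h)]
      ring
  simp only [h, ← Finset.mul_sum, Finset.sum_sub_distrib, Finset.sum_add_distrib, hP.2, hQ.2,
    tvDist]
  ring

lemma tvDist_le_one {P Q : α → ℝ} (hP : P ∈ stdSimplex ℝ α) (hQ : Q ∈ stdSimplex ℝ α) :
    tvDist P Q ≤ 1 := by
  have h := sum_min_eq hP hQ
  have : 0 ≤ ∑ a, min (P a) (Q a) := Finset.sum_nonneg fun a _ => le_min (hP.1 a) (hQ.1 a)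
  linarith

lemma entropyModulus_nonneg {δ : ℝ} (h0 : 0 ≤ δ) (h1 : δ ≤ 1) : 0 ≤ entropyModulus δ := by
  have h2 := negMulLogb_nonneg h0 h1
  have h3 := negMulLogb_nonneg (sub_nonneg.2 h1) (sub_le_self 1 h0)
  unfold entropyModulus
  positivity

/-- A form of Fannes' inequality. -/
lemma sum_negMulLogb_le_of_tvDist [Nonempty α] {P Q : α → ℝ} (hP : P ∈ stdSimplex ℝ α)
    (hQ : Q ∈ stdSimplex ℝ α) :
    ∑ a, negMulLogb (Q a) ≤ ∑ a, negMulLogb (P a) + entropyModulus (tvDist P Q) +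
      tvDist P Q * Real.logb 2 (Fintype.card α) := by
  have hm := sum_min_eq hP hQ
  -- `P` and `Q` share the part `m`; each leftover has mass δ = `tvDist P Q`. Splitting `P` costs
  -- the binary entropy of δ, and bounding the leftover of `Q` costs one more `negMulLogb δ`: this
  -- is the factor 2 in `entropyModulus`.
  set m : α → ℝ := fun a => min (P a) (Q a) with hmdef
  have hm0 : ∀ a, 0 ≤ m a := fun a => le_min (hP.1 a) (hQ.1 a)
  have hs0 : ∀ a, 0 ≤ P a - m a := fun a => sub_nonneg.2 (min_le_left _ _)
  have hr0 : ∀ a, 0 ≤ Q a - m a := fun a => sub_nonneg.2 (min_le_right _ _)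
  have hs : ∑ a, (P a - m a) = tvDist P Q := by
    rw [Finset.sum_sub_distrib, hP.2, hm]; ring
  have hr : ∑ a, (Q a - m a) = tvDist P Q := by
    rw [Finset.sum_sub_distrib, hQ.2, hm]; ring
  have b1 := (sum_negMulLogb_add_bounds hm0 hs0 (by rw [hm, hs]; ring)).2
  have b2 := (sum_negMulLogb_add_bounds hm0 hr0 (by rw [hm, hr]; ring)).1
  have b3 := sum_negMulLogb_le hr0
  have b4 : 0 ≤ ∑ a, negMulLogb (P a - m a) := Finset.sum_nonneg fun a _ => by
    refine negMulLogb_nonneg (hs0 a) ?_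
    have := Finset.single_le_sum (f := P) (fun a _ => hP.1 a) (Finset.mem_univ a)
    rw [hP.2] at this
    linarith [hm0 a]
  simp only [add_sub_cancel, hm, hs, hr] at b1 b2 b3
  unfold entropyModulus
  linarith

lemma sum_prod_mul_apply {n : ℕ} {q : α → ℝ} (hq : ∑ a, q a = 1) (g : α → ℝ) (i : Fin n) :
    ∑ x : Fin n → α, (∏ j, q (x j)) * g (x i) = ∑ a, q a * g a := by
  classical
  -- The factor `g` is absorbed into the `i`-th factor, so the sum over words factorizes.
  have h := Finset.prod_univ_sum (fun _ : Fin n => (Finset.univ : Finset α))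
    (fun j a => if j = i then q a * g a else q a)
  rw [Fintype.piFinset_univ] at h
  have e1 : ∀ x : Fin n → α, ∏ j, (if j = i then q (x j) * g (x j) else q (x j)) =
      (∏ j, q (x j)) * g (x i) := by
    intro x
    have : ∀ j, (if j = i then q (x j) * g (x j) else q (x j)) =
        q (x j) * (if j = i then g (x j) else 1) := by
      intro j; split_ifs <;> simp
    simp only [this, Finset.prod_mul_distrib]
    simp
  simp only [e1] at h
  rw [← h]
  have e2 : ∀ j, ∑ a, (if j = i then q a * g a else q a) =
      if j = i then ∑ a, q a * g a else 1 := by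
    intro j; split_ifs <;> simp [hq]
  simp only [e2]
  simp

lemma sum_prod_eq_one {n : ℕ} {q : α → ℝ} (hq : ∑ a, q a = 1) :
    ∑ x : Fin n → α, ∏ j, q (x j) = 1 := by
  classical
  have h := Finset.prod_univ_sum (fun _ : Fin n => (Finset.univ : Finset α)) (fun _ a => q a)
  rw [Fintype.piFinset_univ] at h
  rw [← h]
  simp [hq]

/-- The entropy of `n` i.i.d. random variables is `n` times the entropy of one of them. -/
lemma sum_negMulLogb_prod {n : ℕ} {q : α → ℝ} (hq : ∑ a, q a = 1) :
    ∑ x : Fin n → α, negMulLogb (∏ j, q (x j)) = n * ∑ a, negMulLogb (q a) := by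
  have h : ∀ x : Fin n → α, negMulLogb (∏ j, q (x j)) =
      ∑ i, (∏ j, q (x j)) * -Real.logb 2 (q (x i)) := by
    intro x
    rw [← Finset.mul_sum, negMulLogb, Finset.sum_neg_distrib, ← mul_neg]
    by_cases h0 : ∏ j, q (x j) = 0
    · simp [h0]
    · rw [Real.logb_prod]
      intro j _ hj
      exact h0 (Finset.prod_eq_zero (Finset.mem_univ j) hj)
  simp only [h]
  rw [Finset.sum_comm]
  simp only [sum_prod_mul_apply hq (fun a => -Real.logb 2 (q a))]
  simp [negMulLogb]

end Bounds

/-- In a finite-dimensional space the convex hull of a compact set is compact. -/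
lemma isCompact_convexHull_of_isCompact {E : Type*} [AddCommGroup E] [Module ℝ E]
    [TopologicalSpace E] [ContinuousAdd E] [ContinuousSMul ℝ E] [FiniteDimensional ℝ E]
    {s : Set E} (hs : IsCompact s) : IsCompact (convexHull ℝ s) := by
  classical
  rcases s.eq_empty_or_nonempty with rfl | ⟨x₀, hx₀⟩
  · simp
  -- By Carathéodory's theorem `N` points always suffice, so the hull is a continuous image of a
  -- compact set. Shorter combinations are padded with weight 0 at `x₀`.
  let N := Module.finrank ℝ E + 1
  let F : (Fin N → ℝ) × (Fin N → E) → E := fun t => ∑ i, t.1 i • t.2 i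
  have hF : Continuous F := by fun_prop
  have hK : IsCompact (stdSimplex ℝ (Fin N) ×ˢ Set.univ.pi fun _ : Fin N => s) :=
    (isCompact_stdSimplex ℝ _).prod (isCompact_univ_pi fun _ => hs)
  convert hK.image hF using 1
  refine Set.Subset.antisymm (fun x hx => ?_) ?_
  · obtain ⟨ι, _, z, w, hz, hai, hw0, hw1, hx⟩ := eq_pos_convex_span_of_mem_convexHull hx
    have hcard : Fintype.card ι ≤ Fintype.card (Fin N) := by
      simpa [N] using hai.card_le_finrank_succ.trans
        (Nat.succ_le_succ (Submodule.finrank_le _))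
    obtain ⟨e⟩ := Function.Embedding.nonempty_of_card_le hcard
    refine ⟨(Function.extend e w 0, Function.extend e z fun _ => x₀),
      ⟨⟨fun j => ?_, ?_⟩, fun j _ => ?_⟩, ?_⟩
    · by_cases hj : ∃ i, e i = j
      · obtain ⟨i, rfl⟩ := hj
        simpa [e.injective.extend_apply] using (hw0 i).le
      · simp [Function.extend_apply' _ _ _ hj]
    · rw [← hw1]
      refine (Fintype.sum_of_injective e e.injective _ _ (fun j hj => ?_) fun i => ?_).symm
      · have hj' : ¬∃ i, e i = j := by simpa using hj
        simp [Function.extend_apply' _ _ _ hj']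
      · simp [e.injective.extend_apply]
    · by_cases hj : ∃ i, e i = j
      · obtain ⟨i, rfl⟩ := hj
        simpa [e.injective.extend_apply] using hz (Set.mem_range_self i)
      · simpa [Function.extend_apply' _ _ _ hj] using hx₀
    · rw [← hx]
      refine (Fintype.sum_of_injective e e.injective _ _ (fun j hj => ?_) fun i => ?_).symm
      · have hj' : ¬∃ i, e i = j := by simpa using hj
        simp [Function.extend_apply' _ _ _ hj']
      · simp [e.injective.extend_apply]
  · rintro _ ⟨⟨w, z⟩, ⟨hw, hz⟩, rfl⟩
    exact mem_convexHull_of_exists_fintype w z hw.1 hw.2 (fun i => hz i trivial) rfl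

/-! ### Joint laws as mixtures of conditional laws. -/

section Mixture

variable {Ω ι T α : Type*} [Fintype Ω] [Fintype ι] [Fintype T] [Fintype α]

lemma law_prod_fst {p : ι × T → ℝ} (i : ι) : law p Prod.fst i = ∑ t, p (i, t) := by
  classical
  simp only [law_apply, Fintype.sum_prod_type]
  rw [Finset.sum_comm]
  simp

lemma law_prod_snd {p : ι × T → ℝ} (t : T) : law p Prod.snd t = ∑ i, p (i, t) := by
  classical
  simp [law_apply, Fintype.sum_prod_type]

/-- Chain rule for the entropy of a mixture. -/
lemma entropy_mixture (w : ι → ℝ) (μ : ι → T → ℝ) (hμ : ∀ i, ∑ t, μ i t = 1) (g : T → α) :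
    entropy (fun s : ι × T => w s.1 * μ s.1 s.2) (fun s => (g s.2, s.1)) =
      ∑ i, (negMulLogb (w i) + w i * entropy (μ i) g) := by
  classical
  have h : ∀ a i, law (fun s : ι × T => w s.1 * μ s.1 s.2) (fun s => (g s.2, s.1)) (a, i) =
      w i * law (μ i) g a := by
    intro a i
    simp only [law_apply, Fintype.sum_prod_type, Prod.mk.injEq, Finset.mul_sum]
    rw [Finset.sum_comm]
    refine Finset.sum_congr rfl fun t _ => ?_
    by_cases hg : g t = a <;> simp [hg]
  rw [entropy_def, Fintype.sum_prod_type, Finset.sum_comm]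
  refine Finset.sum_congr rfl fun i _ => ?_
  simp only [h, negMulLogb_mul, Finset.sum_add_distrib, ← Finset.sum_mul, ← Finset.mul_sum,
    sum_law, hμ, entropy_def, one_mul]

lemma entropy_mixture_fst (w : ι → ℝ) (μ : ι → T → ℝ) (hμ : ∀ i, ∑ t, μ i t = 1) :
    entropy (fun s : ι × T => w s.1 * μ s.1 s.2) Prod.fst = ∑ i, negMulLogb (w i) := by
  rw [entropy_def]
  refine Finset.sum_congr rfl fun i _ => ?_
  simp [law_prod_fst, ← Finset.mul_sum, hμ]

/-- Every joint law is a mixture of conditional laws. -/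
lemma exists_mixture {p : Ω → ℝ} (hp : p ∈ stdSimplex ℝ Ω) (U : Ω → ι) (V : Ω → T) :
    ∃ (w : ι → ℝ) (μ : ι → T → ℝ), w ∈ stdSimplex ℝ ι ∧ (∀ i, μ i ∈ stdSimplex ℝ T) ∧
      law p (fun ω => (U ω, V ω)) = fun s => w s.1 * μ s.1 s.2 := by
  classical
  -- On values of `U` of probability zero any law would do; that of `V` keeps `μ i` in the simplex.
  refine ⟨law p U, fun i t => if law p U i = 0 then law p V t else
    law p (fun ω => (U ω, V ω)) (i, t) / law p U i, law_mem hp U, fun i => ?_, ?_⟩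
  · by_cases h : law p U i = 0
    · simpa [h] using law_mem hp V
    · simp only [h, if_false]
      refine ⟨fun t => div_nonneg (law_nonneg hp.1 _ _) (law_nonneg hp.1 _ _), ?_⟩
      rw [← Finset.sum_div, ← law_fst, div_self h]
  · ext ⟨i, t⟩
    by_cases h : law p U i = 0
    · have h1 := law_fst (p := p) U V i
      rw [h, eq_comm, Finset.sum_eq_zero_iff_of_nonneg fun _ _ => law_nonneg hp.1 _ _] at h1
      simp [h, h1 t (Finset.mem_univ t)]
    · simp [h, mul_div_cancel₀]

lemma continuous_entropy (f : Ω → α) : Continuous fun p : Ω → ℝ => entropy p f := by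
  classical
  simp only [entropy_def, law_apply]
  refine continuous_finsetSum _ fun a _ => continuous_negMulLogb.comp
    (continuous_finsetSum _ fun ω _ => ?_)
  split_ifs <;> fun_prop

end Mixture

/-! ### The convex region that describes all auxiliary variables. -/

section Region

variable {X Y Z Ω ι : Type*} [Fintype X] [Fintype Y] [Fintype Z] [Fintype Ω] [Fintype ι]

/-- The triple of a law `μ` of `(X, Y, Z)`, of `H(Y) + H(Z) - H(X, Y, Z)` and of
`H(X, Y, Z)`. -/
noncomputable def entropyPoint (μ : X × Y × Z → ℝ) : (X × Y × Z → ℝ) × ℝ × ℝ :=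
  (μ, entropy μ (fun t => t.2.1) + entropy μ (fun t => t.2.2) - entropy μ (fun t => t),
    entropy μ (fun t => t))

/-- The set of all triples of the law of `V = (X, Y, Z)`, of `H(Y | U) + H(Z | U) - H(V | U)` and
of `H(V | U)`, where `U` is an auxiliary random variable. -/
noncomputable def entropyRegion (X Y Z : Type*) [Fintype X] [Fintype Y] [Fintype Z] :
    Set ((X × Y × Z → ℝ) × ℝ × ℝ) :=
  convexHull ℝ (entropyPoint '' stdSimplex ℝ (X × Y × Z))

lemma convex_entropyRegion : Convex ℝ (entropyRegion X Y Z) := convex_convexHull _ _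

lemma isCompact_entropyRegion : IsCompact (entropyRegion X Y Z) := by
  refine isCompact_convexHull_of_isCompact ((isCompact_stdSimplex ℝ _).image ?_)
  exact continuous_id.prodMk ((((continuous_entropy _).add (continuous_entropy _)).sub
    (continuous_entropy _)).prodMk (continuous_entropy _))

/-- The triple of the law of `V = (X, Y, Z)`, of `H(Y | U) + H(Z | U) - H(V | U)` and of
`H(V | U)`. -/
noncomputable def condEntropyPoint (p : Ω → ℝ) (U : Ω → ι) (V : Ω → X × Y × Z) :
    (X × Y × Z → ℝ) × ℝ × ℝ :=
  (law p V,
    condEntropy p (fun ω => (V ω).2.1) U + condEntropy p (fun ω => (V ω).2.2) U -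
      condEntropy p V U,
    condEntropy p V U)

lemma condEntropy_mixture {T α : Type*} [Fintype T] [Fintype α] (w : ι → ℝ) (μ : ι → T → ℝ)
    (hμ : ∀ i, ∑ t, μ i t = 1) (g : T → α) :
    condEntropy (fun s : ι × T => w s.1 * μ s.1 s.2) (fun s => g s.2) Prod.fst =
      ∑ i, w i * entropy (μ i) g := by
  rw [condEntropy, entropy_mixture w μ hμ, entropy_mixture_fst w μ hμ, Finset.sum_add_distrib]
  ring

lemma condEntropyPoint_mixture (w : ι → ℝ) (μ : ι → X × Y × Z → ℝ) (hμ : ∀ i, ∑ t, μ i t = 1) :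
    condEntropyPoint (fun s : ι × X × Y × Z => w s.1 * μ s.1 s.2) Prod.fst Prod.snd =
      ∑ i, w i • entropyPoint (μ i) := by
  have h1 := condEntropy_mixture w μ hμ (fun t => t.2.1)
  have h2 := condEntropy_mixture w μ hμ (fun t => t.2.2)
  have h3 := condEntropy_mixture w μ hμ (fun t => t)
  refine Prod.ext ?_ (Prod.ext ?_ ?_)
  · ext t
    simp [condEntropyPoint, entropyPoint, law_prod_snd, Prod.fst_sum]
  · simp only [condEntropyPoint, entropyPoint, Prod.snd_sum, Prod.fst_sum, Prod.smul_snd,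
      Prod.smul_fst, smul_eq_mul, mul_sub, mul_add, Finset.sum_sub_distrib,
      Finset.sum_add_distrib]
    rw [← h1, ← h2, ← h3]
  · simp only [condEntropyPoint, entropyPoint, Prod.snd_sum, Prod.smul_snd, smul_eq_mul]
    exact h3

lemma condEntropy_law {T α : Type*} [Fintype T] [Fintype α] (p : Ω → ℝ) (U : Ω → ι) (V : Ω → T)
    (g : T → α) : condEntropy (law p fun ω => (U ω, V ω)) (fun s => g s.2) Prod.fst =
      condEntropy p (fun ω => g (V ω)) U := by
  simp only [condEntropy, entropy_law]

lemma condEntropyPoint_law (p : Ω → ℝ) (U : Ω → ι) (V : Ω → X × Y × Z) :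
    condEntropyPoint (law p fun ω => (U ω, V ω)) Prod.fst Prod.snd = condEntropyPoint p U V := by
  have h1 := condEntropy_law p U V (fun t => t.2.1)
  have h2 := condEntropy_law p U V (fun t => t.2.2)
  have h3 := condEntropy_law p U V (fun t => t)
  simp only [condEntropyPoint, law_law]
  rw [h1, h2]
  exact congrArg₂ _ rfl (congrArg₂ _ (congrArg _ h3) h3)

lemma condEntropyPoint_mem {p : Ω → ℝ} (hp : p ∈ stdSimplex ℝ Ω) (U : Ω → ι)
    (V : Ω → X × Y × Z) : condEntropyPoint p U V ∈ entropyRegion X Y Z := by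
  obtain ⟨w, μ, hw, hμ, h⟩ := exists_mixture hp U V
  rw [← condEntropyPoint_law, h, condEntropyPoint_mixture w μ fun i => (hμ i).2]
  exact mem_convexHull_of_exists_fintype w _ hw.1 hw.2 (fun i => Set.mem_image_of_mem _ (hμ i)) rfl

lemma entropyPoint_mem {μ : X × Y × Z → ℝ} (hμ : μ ∈ stdSimplex ℝ (X × Y × Z)) :
    entropyPoint μ ∈ entropyRegion X Y Z :=
  subset_convexHull _ _ (Set.mem_image_of_mem _ hμ)

variable {qX : X → ℝ} {W : X → Y × Z → ℝ}

/-- The joint law of the input and of the outputs of the channel. -/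
def channelLaw (qX : X → ℝ) (W : X → Y × Z → ℝ) : X × Y × Z → ℝ :=
  fun t => qX t.1 * W t.1 t.2

lemma channelLaw_mem (hqX : qX ∈ stdSimplex ℝ X) (hW : ∀ x, W x ∈ stdSimplex ℝ (Y × Z)) :
    channelLaw qX W ∈ stdSimplex ℝ (X × Y × Z) := by
  refine ⟨fun t => mul_nonneg (hqX.1 _) ((hW _).1 _), ?_⟩
  rw [Fintype.sum_prod_type]
  simp [channelLaw, ← Finset.mul_sum, (hW _).2, hqX.2]

omit [Fintype X] [Fintype Y] [Fintype Z] in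
lemma jointLaw_eq {k : ℕ} (pU : X × Y × Z → Fin k → ℝ) (s : Fin k × X × Y × Z) :
    jointLaw qX W pU s = channelLaw qX W s.2 * pU s.2 s.1 := rfl

lemma jointLaw_mem (hqX : qX ∈ stdSimplex ℝ X) (hW : ∀ x, W x ∈ stdSimplex ℝ (Y × Z)) {k : ℕ}
    {pU : X × Y × Z → Fin k → ℝ} (hpU : pU ∈ auxChannels X Y Z k) :
    jointLaw qX W pU ∈ stdSimplex ℝ (Fin k × X × Y × Z) := by
  refine ⟨fun s => mul_nonneg ((channelLaw_mem hqX hW).1 s.2) ((hpU s.2).1 s.1), ?_⟩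
  rw [Fintype.sum_prod_type, Finset.sum_comm]
  simp only [jointLaw_eq, ← Finset.mul_sum, (hpU _).2, mul_one]
  exact (channelLaw_mem hqX hW).2

lemma law_jointLaw_snd {k : ℕ} {pU : X × Y × Z → Fin k → ℝ} (hpU : pU ∈ auxChannels X Y Z k) :
    law (jointLaw qX W pU) Prod.snd = channelLaw qX W := by
  ext t
  simp only [law_prod_snd, jointLaw_eq, ← Finset.mul_sum, (hpU _).2, mul_one]

lemma law_channelLaw_fst (hW : ∀ x, W x ∈ stdSimplex ℝ (Y × Z)) :
    law (channelLaw qX W) Prod.fst = qX := by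
  ext x
  simp only [law_prod_fst, channelLaw, ← Finset.mul_sum, (hW _).2, mul_one]

/-- The terms H(Y, Z | U) of the two informations cancel. What remains besides H(X) is affine on
`entropyRegion`. -/
lemma infoSum_eq {k : ℕ} (pU : X × Y × Z → Fin k → ℝ) :
    infoSum qX W pU = entropy (jointLaw qX W pU) (fun s => s.2.1) +
      (condEntropyPoint (jointLaw qX W pU) Prod.fst Prod.snd).2.1 := by
  set p := jointLaw qX W pU
  have e1 : entropy p (fun s => (s.2.2.1, s.2.2.2, s.1)) =
      entropy p (fun s => (s.1, s.2.2.1, s.2.2.2)) :=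
    entropy_congr p (by simp only [Prod.mk.injEq]; tauto)
  have e2 : entropy p (fun s => ((s.1, s.2.2.1, s.2.2.2), s.2.1)) =
      entropy p (fun s => (s.2, s.1)) :=
    entropy_congr p (by simp only [Prod.ext_iff]; tauto)
  change condMutualInfo p (fun s => s.2.2.1) (fun s => s.2.2.2) (fun s => s.1) +
    mutualInfo p (fun s => (s.1, s.2.2.1, s.2.2.2)) (fun s => s.2.1) = entropy p (fun s => s.2.1) +
    (condEntropy p (fun s => s.2.2.1) (fun s => s.1) +
      condEntropy p (fun s => s.2.2.2) (fun s => s.1) - condEntropy p (fun s => s.2) (fun s => s.1))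
  simp only [condMutualInfo, mutualInfo, condEntropy, e1, e2]
  ring

lemma infoAux_eq {k : ℕ} (pU : X × Y × Z → Fin k → ℝ) :
    infoAux qX W pU = entropy (jointLaw qX W pU) Prod.snd -
      (condEntropyPoint (jointLaw qX W pU) Prod.fst Prod.snd).2.2 := by
  set p := jointLaw qX W pU
  have e1 : entropy p (fun s => (s.1, s.2)) = entropy p (fun s => (s.2, s.1)) :=
    entropy_congr p (by simp only [Prod.ext_iff]; tauto)
  change mutualInfo p (fun s => s.1) (fun s => s.2) = entropy p (fun s => s.2) -
    condEntropy p (fun s => s.2) (fun s => s.1)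
  simp only [mutualInfo, condEntropy, e1]
  ring

lemma entropy_jointLaw_snd {k : ℕ} {pU : X × Y × Z → Fin k → ℝ} (hpU : pU ∈ auxChannels X Y Z k) :
    entropy (jointLaw qX W pU) Prod.snd = ∑ t, negMulLogb (channelLaw qX W t) := by
  rw [entropy_def, law_jointLaw_snd hpU]

lemma entropy_jointLaw_input (hW : ∀ x, W x ∈ stdSimplex ℝ (Y × Z)) {k : ℕ}
    {pU : X × Y × Z → Fin k → ℝ} (hpU : pU ∈ auxChannels X Y Z k) :
    entropy (jointLaw qX W pU) (fun s => s.2.1) = ∑ x, negMulLogb (qX x) := by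
  rw [← entropy_law (jointLaw qX W pU) Prod.snd Prod.fst, law_jointLaw_snd hpU, entropy_def,
    law_channelLaw_fst hW]

/-- The pairs of information quantities that auxiliary channels attain are the points of
`entropyRegion` over the law of the channel. -/
lemma exists_auxChannel_iff (hqX : qX ∈ stdSimplex ℝ X) (hW : ∀ x, W x ∈ stdSimplex ℝ (Y × Z))
    (a b : ℝ) :
    (∃ k : ℕ, ∃ pU ∈ auxChannels X Y Z k, infoSum qX W pU = a ∧ infoAux qX W pU = b) ↔
      (channelLaw qX W, a - ∑ x, negMulLogb (qX x), ∑ t, negMulLogb (channelLaw qX W t) - b) ∈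
        entropyRegion X Y Z := by
  constructor
  · rintro ⟨k, pU, hpU, rfl, rfl⟩
    convert condEntropyPoint_mem (jointLaw_mem hqX hW hpU) Prod.fst Prod.snd using 1
    refine Prod.ext (law_jointLaw_snd hpU).symm (Prod.ext ?_ ?_)
    · simp only
      rw [infoSum_eq, entropy_jointLaw_input hW hpU, add_sub_cancel_left]
    · simp only
      rw [infoAux_eq, entropy_jointLaw_snd hpU, sub_sub_cancel]
  · intro h
    rw [entropyRegion, mem_convexHull_iff_exists_fintype] at h
    obtain ⟨ι, _, w, z, hw0, hw1, hz, h⟩ := h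
    choose μ hμ hz using hz
    let e := Fintype.equivFin ι
    set q := channelLaw qX W with hq
    have hqμ : ∀ t, ∑ i, w i * μ i t = q t := by
      intro t
      have h1 := congrFun (congrArg Prod.fst h) t
      simpa [Prod.fst_sum, ← hz, entropyPoint] using h1
    classical
    -- Bayes' rule: the weights and components of the convex combination become a conditional law of
    -- the index. Where `q t = 0` the joint law vanishes anyway, and `w` serves as a default.
    let pU : X × Y × Z → Fin (Fintype.card ι) → ℝ := fun t j =>
      if q t = 0 then w (e.symm j) else w (e.symm j) * μ (e.symm j) t / q t
    have hpU : pU ∈ auxChannels X Y Z (Fintype.card ι) := by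
      intro t
      by_cases h0 : q t = 0
      · simp only [pU, h0, if_true]
        exact ⟨fun j => hw0 _, by rw [Equiv.sum_comp e.symm w, hw1]⟩
      · simp only [pU, h0, if_false]
        refine ⟨fun j => div_nonneg (mul_nonneg (hw0 _) ((hμ _).1 t))
          ((channelLaw_mem hqX hW).1 t), ?_⟩
        rw [Equiv.sum_comp e.symm (fun i => w i * μ i t / q t), ← Finset.sum_div, hqμ,
          div_self h0]
    have hp : jointLaw qX W pU = fun s => w (e.symm s.1) * μ (e.symm s.1) s.2 := by
      ext s
      rw [jointLaw_eq, ← hq]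
      by_cases h0 : q s.2 = 0
      · have h1 := hqμ s.2
        rw [h0, Finset.sum_eq_zero_iff_of_nonneg fun i _ => mul_nonneg (hw0 i) ((hμ i).1 _)] at h1
        rw [h0, zero_mul, h1 _ (Finset.mem_univ _)]
      · simp only [pU, h0, if_false]
        rw [mul_div_cancel₀ _ h0]
    have hpt : condEntropyPoint (jointLaw qX W pU) Prod.fst Prod.snd =
        (q, a - ∑ x, negMulLogb (qX x), ∑ t, negMulLogb (q t) - b) := by
      rw [hp, condEntropyPoint_mixture (fun j => w (e.symm j)) (fun j => μ (e.symm j))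
        fun j => (hμ _).2, Equiv.sum_comp e.symm (fun i => w i • entropyPoint (μ i)), ← h]
      simp only [hz]
    refine ⟨_, pU, hpU, ?_, ?_⟩
    · rw [infoSum_eq, hpt, entropy_jointLaw_input hW hpU]
      ring
    · rw [infoAux_eq, hpt, entropy_jointLaw_snd hpU]
      ring

end Region

/-! ### Attainment and equality of the two minima. -/

section Minimum

variable {X Y Z : Type*} [Fintype X] [Fintype Y] [Fintype Z] {qX : X → ℝ} {W : X → Y × Z → ℝ}

/-- The pairs `(I(Y; Z | U) + I(U, Y, Z; X), I(U; X, Y, Z))` that auxiliary channels attain. -/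
def attainablePairs (qX : X → ℝ) (W : X → Y × Z → ℝ) : Set (ℝ × ℝ) :=
  {c | ∃ k : ℕ, ∃ pU ∈ auxChannels X Y Z k, infoSum qX W pU = c.1 ∧ infoAux qX W pU = c.2}

lemma mem_attainablePairs_iff (hqX : qX ∈ stdSimplex ℝ X)
    (hW : ∀ x, W x ∈ stdSimplex ℝ (Y × Z)) (c : ℝ × ℝ) :
    c ∈ attainablePairs qX W ↔
      (channelLaw qX W, c.1 - ∑ x, negMulLogb (qX x),
        ∑ t, negMulLogb (channelLaw qX W t) - c.2) ∈ entropyRegion X Y Z :=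
  exists_auxChannel_iff hqX hW c.1 c.2

lemma isCompact_attainablePairs (hqX : qX ∈ stdSimplex ℝ X)
    (hW : ∀ x, W x ∈ stdSimplex ℝ (Y × Z)) : IsCompact (attainablePairs qX W) := by
  have h1 : IsCompact (entropyRegion X Y Z ∩ {s | s.1 = channelLaw qX W}) :=
    isCompact_entropyRegion.inter_right (isClosed_eq continuous_fst continuous_const)
  let f : (X × Y × Z → ℝ) × ℝ × ℝ → ℝ × ℝ := fun s =>
    (∑ x, negMulLogb (qX x) + s.2.1, ∑ t, negMulLogb (channelLaw qX W t) - s.2.2)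
  have hf : Continuous f := by fun_prop
  convert h1.image hf using 1
  ext c
  rw [mem_attainablePairs_iff hqX hW]
  constructor
  · intro h
    exact ⟨_, ⟨h, rfl⟩, Prod.ext (by simp [f]) (by simp [f])⟩
  · rintro ⟨⟨μ, a, b⟩, ⟨hs, rfl⟩, rfl⟩
    simpa [f] using hs

lemma convex_attainablePairs (hqX : qX ∈ stdSimplex ℝ X)
    (hW : ∀ x, W x ∈ stdSimplex ℝ (Y × Z)) : Convex ℝ (attainablePairs qX W) := by
  intro c hc d hd l m hl hm hlm
  rw [mem_attainablePairs_iff hqX hW] at hc hd ⊢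
  convert convex_entropyRegion hc hd hl hm hlm using 1
  refine Prod.ext ?_ (Prod.ext ?_ ?_)
  · simp [← add_smul, hlm]
  · simp only [Prod.fst_add, Prod.snd_add, Prod.smul_fst, Prod.smul_snd, smul_eq_mul]
    linear_combination (∑ x, negMulLogb (qX x)) * hlm
  · simp only [Prod.snd_add, Prod.smul_snd, smul_eq_mul]
    linear_combination -(∑ t, negMulLogb (channelLaw qX W t)) * hlm

/-- A constant auxiliary variable attains a pair `(c, 0)`, where `c` is at most the sum of the
coordinates of any other attainable pair. -/
lemma exists_mem_attainablePairs_snd_zero (hqX : qX ∈ stdSimplex ℝ X)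
    (hW : ∀ x, W x ∈ stdSimplex ℝ (Y × Z)) :
    ∃ c, (c, (0 : ℝ)) ∈ attainablePairs qX W ∧
      ∀ d ∈ attainablePairs qX W, 0 ≤ d.1 ∧ c ≤ d.1 + d.2 := by
  set q := channelLaw qX W with hq
  have hqm := channelLaw_mem hqX hW
  refine ⟨∑ x, negMulLogb (qX x) + (entropyPoint q).2.1, ?_, ?_⟩
  · rw [mem_attainablePairs_iff hqX hW]
    convert entropyPoint_mem hqm using 1
    refine Prod.ext rfl (Prod.ext (by simp [hq]) ?_)
    change _ = entropy q (fun t => t)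
    rw [entropy_def, law_id]
    simp [hq]
  · rintro ⟨_, _⟩ ⟨k, pU, hpU, rfl, rfl⟩
    have hp := jointLaw_mem hqX hW hpU
    have hl := law_jointLaw_snd (qX := qX) (W := W) hpU
    have e1 := entropy_law (jointLaw qX W pU) Prod.snd (fun t => t.2.1)
    have e2 := entropy_law (jointLaw qX W pU) Prod.snd (fun t => t.2.2)
    have e3 := entropy_law (jointLaw qX W pU) Prod.snd (fun t => t)
    have e4 := entropy_jointLaw_input (qX := qX) hW hpU
    rw [hl] at e1 e2 e3
    simp only [infoSum_eq, infoAux_eq, ← e4, entropyPoint, condEntropyPoint, condEntropy]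
    rw [← hq] at e1 e2 e3
    rw [e1, e2, e3]
    set p := jointLaw qX W pU
    -- `s1` and `s2` say I(U;Y) ≤ I(U;V) and I(U;Z) ≤ I(U;V); since `c` minus `d.1 + d.2` equals
    -- I(U;Y) + I(U;Z) - 2 I(U;V), this gives the upper bound on `c`. `s3` and `s4` say I(Y;Z|U) ≥ 0
    -- and I(X;U,Y,Z) ≥ 0, hence `0 ≤ d.1`.
    have s1 := entropy_submodular hp.1 (fun s => s.1) (fun s => (s.2.1, s.2.2.2))
      (fun s => s.2.2.1)
    have s2 := entropy_submodular hp.1 (fun s => s.1) (fun s => (s.2.1, s.2.2.1))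
      (fun s => s.2.2.2)
    have s3 := entropy_submodular hp.1 (fun s => s.2.2.1) (fun s => s.2.2.2) (fun s => s.1)
    have s4 := entropy_pair_le hp (fun s => s.2.1) (fun s => (s.2.2.1, s.2.2.2, s.1))
    have c1 : entropy p (fun s => (s.1, (s.2.1, s.2.2.2), s.2.2.1)) =
        entropy p (fun s => (s.2, s.1)) :=
      entropy_congr p (by simp only [Prod.ext_iff]; tauto)
    have c2 : entropy p (fun s => (s.1, (s.2.1, s.2.2.1), s.2.2.2)) =
        entropy p (fun s => (s.2, s.1)) :=
      entropy_congr p (by simp only [Prod.ext_iff]; tauto)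
    have c3 : entropy p (fun s => ((s.2.1, s.2.2.2), s.2.2.1)) = entropy p (fun s => s.2) :=
      entropy_congr p (by simp only [Prod.ext_iff]; tauto)
    have c4 : entropy p (fun s => ((s.2.1, s.2.2.1), s.2.2.2)) = entropy p (fun s => s.2) :=
      entropy_congr p (by simp only [Prod.ext_iff]; tauto)
    have c5 : entropy p (fun s => (s.1, s.2.2.1)) = entropy p (fun s => (s.2.2.1, s.1)) :=
      entropy_congr p (by simp only [Prod.ext_iff]; tauto)
    have c6 : entropy p (fun s => (s.1, s.2.2.2)) = entropy p (fun s => (s.2.2.2, s.1)) :=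
      entropy_congr p (by simp only [Prod.ext_iff]; tauto)
    have c7 : entropy p (fun s => (s.2.1, (s.2.2.1, s.2.2.2, s.1))) =
        entropy p (fun s => (s.2, s.1)) :=
      entropy_congr p (by simp only [Prod.ext_iff]; tauto)
    rw [c1, c3, c5] at s1
    rw [c2, c4, c6] at s2
    rw [c7] at s4
    constructor <;> linarith

/-- Both minima of the lower bound are attained, and they agree. -/
lemma exists_isLeast_attainablePairs (hqX : qX ∈ stdSimplex ℝ X)
    (hW : ∀ x, W x ∈ stdSimplex ℝ (Y × Z)) :
    ∃ v, IsLeast ((fun c : ℝ × ℝ => max c.1 ((1 / 2) * (c.1 + c.2))) '' attainablePairs qX W) v ∧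
      IsLeast ((fun c : ℝ × ℝ => max c.1 c.2) '' attainablePairs qX W) v := by
  obtain ⟨c₀, hc₀, hle⟩ := exists_mem_attainablePairs_snd_zero hqX hW
  have hcont : Continuous fun c : ℝ × ℝ => max c.1 ((1 / 2) * (c.1 + c.2)) := by fun_prop
  obtain ⟨v, hv⟩ := ((isCompact_attainablePairs hqX hW).image hcont).exists_isLeast
    ⟨_, Set.mem_image_of_mem _ hc₀⟩
  have hhalf : ∀ c : ℝ × ℝ, max c.1 ((1 / 2) * (c.1 + c.2)) ≤ max c.1 c.2 := fun c =>
    max_le (le_max_left _ _) (by linarith [le_max_left c.1 c.2, le_max_right c.1 c.2])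
  have hlow : v ∈ lowerBounds ((fun c : ℝ × ℝ => max c.1 c.2) '' attainablePairs qX W) := by
    rintro _ ⟨c, hc, rfl⟩
    exact (hv.2 (Set.mem_image_of_mem _ hc)).trans (hhalf c)
  refine ⟨v, hv, ?_, hlow⟩
  obtain ⟨⟨a, b⟩, hab, rfl⟩ := hv.1
  rcases le_or_gt b a with h | h
  · refine ⟨_, hab, ?_⟩
    simp only
    rw [max_eq_left h, max_eq_left (by linarith)]
  · obtain ⟨ha, hcab⟩ := hle _ hab
    simp only at ha hcab hlow ⊢
    have hb : 0 < b := ha.trans_lt h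
    -- The weight l = (a + b) / (2b) brings the second coordinate l b to (a + b) / 2. As c₀ ≤ a + b,
    -- the first is at most l a + (1 - l)(a + b) = (a + b) / 2 too.
    have hmem := convex_attainablePairs hqX hW hab hc₀ (a := (a + b) / (2 * b))
      (b := 1 - (a + b) / (2 * b)) (by positivity)
      (by rw [sub_nonneg, div_le_one (by positivity)]; linarith) (by ring)
    set l := (a + b) / (2 * b) with hl
    have hlb : l * b = (a + b) / 2 := by rw [hl]; field_simp
    have hl1 : 0 ≤ 1 - l := by rw [sub_nonneg, hl, div_le_one (by positivity)]; linarith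
    refine ⟨_, hmem, le_antisymm ?_ (hlow (Set.mem_image_of_mem _ hmem))⟩
    rw [max_eq_right (a := a) (by linarith)]
    simp only [Prod.fst_add, Prod.snd_add, Prod.smul_fst, Prod.smul_snd, smul_eq_mul]
    refine max_le ?_ (by linarith)
    have := mul_le_mul_of_nonneg_left hcab hl1
    nlinarith

end Minimum

/-! ### Single-letterization. -/

section SingleLetter

variable {Ω α β γ ι : Type*} [Fintype Ω] [Fintype α] [Fintype β] [Fintype γ] [Fintype ι]

/-- Conditioning on more reduces the entropy. -/
lemma condEntropy_anti {p : Ω → ℝ} (hp : ∀ ω, 0 ≤ p ω) (f : Ω → α) {g : Ω → β} {g' : Ω → γ}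
    (h : ∀ ω ω', g' ω = g' ω' → g ω = g ω') : condEntropy p f g' ≤ condEntropy p f g := by
  have h1 := entropy_submodular hp f g' g
  have e1 : entropy p (fun ω => (f ω, g' ω, g ω)) = entropy p (fun ω => (f ω, g' ω)) :=
    entropy_congr p fun ω ω' => by
      have := h ω ω'
      simp only [Prod.mk.injEq]
      tauto
  have e2 : entropy p (fun ω => (g' ω, g ω)) = entropy p g' :=
    entropy_congr p fun ω ω' => by
      have := h ω ω'
      simp only [Prod.mk.injEq]
      tauto
  rw [e1, e2] at h1
  unfold condEntropy
  linarith

/-- The chain rule for the conditional entropy of a random vector. -/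
lemma condEntropy_chain {n : ℕ} (p : Ω → ℝ) (U : Ω → ι) (f : Ω → Fin n → α) :
    condEntropy p f U = ∑ i : Fin n, condEntropy p (fun ω => f ω i)
      (fun ω => (U ω, fun j : {j : Fin n // j.val < i.val} => f ω j)) := by
  -- `E i` is the entropy of `U` with the first `i` letters; the chain rule is the telescoping sum
  -- of its increments.
  let E : ℕ → ℝ := fun i =>
    entropy p (fun ω => (U ω, fun j : {j : Fin n // j.val < i} => f ω j))
  have hE : ∀ i : Fin n, condEntropy p (fun ω => f ω i)
      (fun ω => (U ω, fun j : {j : Fin n // j.val < i.val} => f ω j)) = E (i + 1) - E i := by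
    intro i
    refine congrArg (· - E i) (entropy_congr p fun ω ω' => ?_)
    simp only [Prod.mk.injEq, funext_iff, Subtype.forall, Nat.lt_succ_iff]
    constructor
    · rintro ⟨h1, h2, h3⟩
      refine ⟨h2, fun j hj => ?_⟩
      rcases hj.lt_or_eq with hj | hj
      · exact h3 j hj
      · rwa [Fin.ext hj]
    · rintro ⟨h1, h2⟩
      exact ⟨h2 i le_rfl, h1, fun j hj => h2 j hj.le⟩
  rw [Finset.sum_congr rfl fun i _ => hE i,
    Fin.sum_univ_eq_sum_range (fun i => E (i + 1) - E i) n, Finset.sum_range_sub]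
  refine congrArg₂ _ (entropy_congr p fun ω ω' => ?_) (entropy_congr p fun ω ω' => ?_)
  · simp only [Prod.mk.injEq, funext_iff, Subtype.forall]
    exact ⟨fun h => ⟨h.2, fun j _ => h.1 j⟩, fun h => ⟨fun j => h.2 j j.2, h.1⟩⟩
  · simp [funext_iff]

variable {X Y Z : Type*} [Fintype X] [Fintype Y] [Fintype Z]

/-- Single-letterization: the triple of a random vector of length `n` dominates `n` times a point
of `entropyRegion`. -/
lemma exists_mem_entropyRegion {n : ℕ} (hn : 1 ≤ n) {p : Ω → ℝ} (hp : p ∈ stdSimplex ℝ Ω)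
    (U : Ω → ι) (V : Ω → Fin n → X × Y × Z) :
    ∃ s ∈ entropyRegion X Y Z, s.1 = (n : ℝ)⁻¹ • ∑ i, law p (fun ω => V ω i) ∧
      n * s.2.1 ≤ condEntropy p (fun ω i => (V ω i).2.1) U +
        condEntropy p (fun ω i => (V ω i).2.2) U - condEntropy p V U ∧
      n * s.2.2 = condEntropy p V U := by
  have hn0 : (n : ℝ) ≠ 0 := by positivity
  -- The auxiliary variable contains the past of all three components. The chain rule for `V` is
  -- then an equality, while for the Y and Z components, whose chain rules use only their own past,
  -- the extra conditioning lowers the entropy, as the inequality requires.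
  let U' : (i : Fin n) → Ω → ι × ({j : Fin n // j.val < i.val} → X × Y × Z) :=
    fun i ω => (U ω, fun j => V ω j)
  let s : Fin n → (X × Y × Z → ℝ) × ℝ × ℝ := fun i => condEntropyPoint p (U' i) (fun ω => V ω i)
  have hV := condEntropy_chain p U V
  have hY := condEntropy_chain p U (fun ω i => (V ω i).2.1)
  have hZ := condEntropy_chain p U (fun ω i => (V ω i).2.2)
  refine ⟨∑ i, (n : ℝ)⁻¹ • s i, ?_, ?_, ?_, ?_⟩
  · refine convex_entropyRegion.sum_mem (fun _ _ => by positivity) ?_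
      fun i _ => condEntropyPoint_mem hp _ _
    simp [hn0]
  · simp only [← Finset.smul_sum, Prod.smul_fst, Prod.fst_sum]
    rfl
  · simp only [← Finset.smul_sum, Prod.smul_fst, Prod.smul_snd, Prod.fst_sum, Prod.snd_sum,
      smul_eq_mul, mul_inv_cancel_left₀ hn0]
    rw [hV, hY, hZ, ← Finset.sum_add_distrib, ← Finset.sum_sub_distrib]
    refine Finset.sum_le_sum fun i _ => sub_le_sub_right (add_le_add ?_ ?_) _
    · refine condEntropy_anti hp.1 _ fun ω ω' h => ?_
      simp only [U', Prod.mk.injEq, funext_iff] at h ⊢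
      exact ⟨h.1, fun j => by rw [h.2 j]⟩
    · refine condEntropy_anti hp.1 _ fun ω ω' h => ?_
      simp only [U', Prod.mk.injEq, funext_iff] at h ⊢
      exact ⟨h.1, fun j => by rw [h.2 j]⟩
  · simp only [← Finset.smul_sum, Prod.smul_snd, Prod.snd_sum, smul_eq_mul,
      mul_inv_cancel_left₀ hn0]
    rw [hV]
    rfl

end SingleLetter

/-! ### The one-shot converse for a single code. -/

section OneShot

variable {F G H : Type*} [Fintype F] [Fintype G] [Fintype H]

/-- The joint law of a random variable with law `r` and of the output of the kernel `κ`. -/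
def jointPMF (r : F → ℝ) (κ : F → G → ℝ) : F × G → ℝ := fun s => r s.1 * κ s.1 s.2

lemma jointPMF_mem {r : F → ℝ} {κ : F → G → ℝ} (hr : r ∈ stdSimplex ℝ F)
    (hκ : ∀ f, κ f ∈ stdSimplex ℝ G) : jointPMF r κ ∈ stdSimplex ℝ (F × G) := by
  refine ⟨fun s => mul_nonneg (hr.1 _) ((hκ _).1 _), ?_⟩
  rw [Fintype.sum_prod_type]
  simp [jointPMF, ← Finset.mul_sum, (hκ _).2, hr.2]

lemma law_jointPMF_fst (r : F → ℝ) {κ : F → G → ℝ} (hκ : ∀ f, κ f ∈ stdSimplex ℝ G) :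
    law (jointPMF r κ) Prod.fst = r := by
  ext f
  simp [law_prod_fst, jointPMF, ← Finset.mul_sum, (hκ _).2]

lemma entropy_jointPMF_fst (r : F → ℝ) {κ : F → G → ℝ} (hκ : ∀ f, κ f ∈ stdSimplex ℝ G)
    (h : F → H) : entropy (jointPMF r κ) (fun s => h s.1) = entropy r h := by
  rw [← entropy_law (jointPMF r κ) Prod.fst h, law_jointPMF_fst r hκ]

/-- The output of a kernel that sees only `h` is conditionally independent of the rest given `h`. -/
lemma entropy_jointPMF {r : F → ℝ} (hr : r ∈ stdSimplex ℝ F) (h : F → H) {κ : H → G → ℝ}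
    (hκ : ∀ c, κ c ∈ stdSimplex ℝ G) :
    entropy (jointPMF r fun f => κ (h f)) (fun s => s) + entropy r h =
      entropy r (fun f => f) +
        entropy (jointPMF r fun f => κ (h f)) (fun s => (h s.1, s.2)) := by
  have h1 := entropy_of_factor (jointPMF_mem hr fun f => hκ (h f)).1 Prod.fst Prod.snd h κ
    fun a b => by
      rw [law_jointPMF_fst r fun f => hκ (h f)]
      exact congrFun (law_id _) (a, b)
  have h2 := entropy_jointPMF_fst r (fun f => hκ (h f)) (fun f => f)
  rw [entropy_jointPMF_fst r fun f => hκ (h f)] at h1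
  rw [← h2]
  exact h1

variable {A B C S T M : Type*} [Fintype A] [Fintype B] [Fintype C] [Fintype S] [Fintype T]
  [Fintype M]

/-- The joint law of `(X, Θ₁, Θ₂)`. -/
def sourcePMF (P : A → ℝ) (p₁ : S → ℝ) (p₂ : T → ℝ) : (A × S) × T → ℝ :=
  jointPMF (jointPMF P fun _ => p₁) fun _ => p₂

/-- The joint law of `(X, Θ₁, Θ₂, M, Y, Z)` in a code. -/
def codePMF (P : A → ℝ) (p₁ : S → ℝ) (p₂ : T → ℝ) (e : A → S → T → M → ℝ) (d₁ : M → S → B → ℝ)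
    (d₂ : M → T → C → ℝ) : ((((A × S) × T) × M) × B) × C → ℝ :=
  jointPMF (jointPMF (jointPMF (sourcePMF P p₁ p₂) fun s => e s.1.1 s.1.2 s.2)
    fun s => d₁ s.2 s.1.1.2) fun s => d₂ s.1.2 s.1.1.2

variable {P : A → ℝ} {p₁ : S → ℝ} {p₂ : T → ℝ} {e : A → S → T → M → ℝ} {d₁ : M → S → B → ℝ}
    {d₂ : M → T → C → ℝ}

lemma entropy_sourcePMF (hP : P ∈ stdSimplex ℝ A) (h₁ : p₁ ∈ stdSimplex ℝ S)
    (h₂ : p₂ ∈ stdSimplex ℝ T) :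
    entropy (sourcePMF P p₁ p₂) (fun s => s) =
      entropy (sourcePMF P p₁ p₂) (fun s => s.1.1) +
      entropy (sourcePMF P p₁ p₂) (fun s => s.1.2) +
      entropy (sourcePMF P p₁ p₂) (fun s => s.2) := by
  have hr := jointPMF_mem hP fun _ => h₁
  have b1 := entropy_pair_of_indep (jointPMF_mem hr fun _ => h₂) Prod.fst Prod.snd p₂
    fun a b => by
      rw [law_jointPMF_fst _ fun _ => h₂]
      exact congrFun (law_id _) (a, b)
  have b2 := entropy_pair_of_indep hr Prod.fst Prod.snd p₁
    fun a b => by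
      rw [law_jointPMF_fst _ fun _ => h₁]
      exact congrFun (law_id _) (a, b)
  have c1 := entropy_jointPMF_fst (jointPMF P fun _ => p₁) (fun _ => h₂) (fun f => f)
  have c2 := entropy_jointPMF_fst (jointPMF P fun _ => p₁) (fun _ => h₂) (fun f => f.1)
  have c3 := entropy_jointPMF_fst (jointPMF P fun _ => p₁) (fun _ => h₂) (fun f => f.2)
  unfold sourcePMF
  rw [c2, c3]
  exact b1.trans (congrArg (· + _) (c1.trans b2))

lemma codePMF_mem (hP : P ∈ stdSimplex ℝ A) (h₁ : p₁ ∈ stdSimplex ℝ S)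
    (h₂ : p₂ ∈ stdSimplex ℝ T) (he : ∀ x a b, e x a b ∈ stdSimplex ℝ M)
    (hd₁ : ∀ c a, d₁ c a ∈ stdSimplex ℝ B) (hd₂ : ∀ c b, d₂ c b ∈ stdSimplex ℝ C) :
    codePMF P p₁ p₂ e d₁ d₂ ∈ stdSimplex ℝ (((((A × S) × T) × M) × B) × C) :=
  jointPMF_mem (jointPMF_mem (jointPMF_mem (jointPMF_mem (jointPMF_mem hP fun _ => h₁)
    fun _ => h₂) fun _ => he _ _ _) fun _ => hd₁ _ _) fun _ => hd₂ _ _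

/-- All that the converse uses about codes: H(X) + H(Θ₁) + H(Θ₂) ≤ H(X, Θ₁, Θ₂, M) by independence,
after which the decoders add exactly H(Y | M, Θ₁) and H(Z | M, Θ₂). -/
lemma codePMF_entropy_ge (hP : P ∈ stdSimplex ℝ A) (h₁ : p₁ ∈ stdSimplex ℝ S)
    (h₂ : p₂ ∈ stdSimplex ℝ T) (he : ∀ x a b, e x a b ∈ stdSimplex ℝ M)
    (hd₁ : ∀ c a, d₁ c a ∈ stdSimplex ℝ B) (hd₂ : ∀ c b, d₂ c b ∈ stdSimplex ℝ C) :
    entropy (codePMF P p₁ p₂ e d₁ d₂) (fun s => s.1.1.1.1.1) +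
      entropy (codePMF P p₁ p₂ e d₁ d₂) (fun s => s.1.1.1.1.2) +
      entropy (codePMF P p₁ p₂ e d₁ d₂) (fun s => s.1.1.1.2) +
      entropy (codePMF P p₁ p₂ e d₁ d₂) (fun s => ((s.1.1.2, s.1.1.1.1.2), s.1.2)) +
      entropy (codePMF P p₁ p₂ e d₁ d₂) (fun s => ((s.1.1.2, s.1.1.1.2), s.2)) ≤
    entropy (codePMF P p₁ p₂ e d₁ d₂) (fun s => s) +
      entropy (codePMF P p₁ p₂ e d₁ d₂) (fun s => (s.1.1.2, s.1.1.1.1.2)) +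
      entropy (codePMF P p₁ p₂ e d₁ d₂) (fun s => (s.1.1.2, s.1.1.1.2)) := by
  have hs := entropy_sourcePMF hP h₁ h₂
  have hr₂ : sourcePMF P p₁ p₂ ∈ stdSimplex ℝ ((A × S) × T) :=
    jointPMF_mem (jointPMF_mem hP fun _ => h₁) fun _ => h₂
  unfold codePMF
  generalize sourcePMF P p₁ p₂ = r₂ at hs hr₂ ⊢
  have he' : ∀ s : (A × S) × T, e s.1.1 s.1.2 s.2 ∈ stdSimplex ℝ M := fun _ => he _ _ _
  have hr₃ := jointPMF_mem hr₂ he'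
  have u₂ := entropy_jointPMF_fst r₂ he' fun s => s.1.1
  have v₂ := entropy_jointPMF_fst r₂ he' fun s => s.1.2
  have w₂ := entropy_jointPMF_fst r₂ he' fun s => s.2
  have x₂ := entropy_jointPMF_fst r₂ he' fun s => s
  have mono := entropy_mono hr₃.1 (f := fun s => s.1) (g := fun s => s) fun _ _ h => h ▸ rfl
  rw [x₂, hs, ← u₂, ← v₂, ← w₂] at mono
  generalize (jointPMF r₂ fun s => e s.1.1 s.1.2 s.2) = r₃ at mono hr₃ ⊢
  have hd₁' : ∀ s : ((A × S) × T) × M, d₁ s.2 s.1.1.2 ∈ stdSimplex ℝ B := fun _ => hd₁ _ _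
  have hr₄ := jointPMF_mem hr₃ hd₁'
  have f₁ := entropy_jointPMF hr₃ (fun s => (s.2, s.1.1.2)) (κ := fun c => d₁ c.1 c.2)
    fun _ => hd₁ _ _
  simp only at f₁
  rw [← entropy_jointPMF_fst r₃ hd₁' fun s => (s.2, s.1.1.2)] at f₁
  rw [← entropy_jointPMF_fst r₃ hd₁' fun s => s.1.1.1,
    ← entropy_jointPMF_fst r₃ hd₁' fun s => s.1.1.2,
    ← entropy_jointPMF_fst r₃ hd₁' fun s => s.1.2] at mono
  generalize entropy r₃ (fun s => s) = h₃ at mono f₁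
  generalize (jointPMF r₃ fun s => d₁ s.2 s.1.1.2) = r₄ at mono hr₄ f₁ ⊢
  have hd₂' : ∀ s : (((A × S) × T) × M) × B, d₂ s.1.2 s.1.1.2 ∈ stdSimplex ℝ C :=
    fun _ => hd₂ _ _
  have f₂ := entropy_jointPMF hr₄ (fun s => (s.1.2, s.1.1.2)) (κ := fun c => d₂ c.1 c.2)
    fun _ => hd₂ _ _
  simp only at f₂
  rw [entropy_jointPMF_fst r₄ hd₂' fun s => s.1.1.1.1,
    entropy_jointPMF_fst r₄ hd₂' fun s => s.1.1.1.2,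
    entropy_jointPMF_fst r₄ hd₂' fun s => s.1.1.2,
    entropy_jointPMF_fst r₄ hd₂' fun s => ((s.1.2, s.1.1.1.2), s.2),
    entropy_jointPMF_fst r₄ hd₂' fun s => (s.1.2, s.1.1.1.2),
    entropy_jointPMF_fst r₄ hd₂' fun s => (s.1.2, s.1.1.2)]
  linarith

/-- The message of a code is at least as uncertain as `I(Y; Z | M) + I(M, Y, Z; X)`. -/
lemma infoSum_le_entropy {Ω : Type*} [Fintype Ω] {p : Ω → ℝ} (hp : p ∈ stdSimplex ℝ Ω)
    (x : Ω → A) (a : Ω → S) (b : Ω → T) (m : Ω → M) (y : Ω → B) (z : Ω → C)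
    (h : entropy p x + entropy p a + entropy p b + entropy p (fun ω => ((m ω, a ω), y ω)) +
        entropy p (fun ω => ((m ω, b ω), z ω)) ≤
      entropy p (fun ω => (((((x ω, a ω), b ω), m ω), y ω), z ω)) +
        entropy p (fun ω => (m ω, a ω)) + entropy p (fun ω => (m ω, b ω))) :
    entropy p x + condEntropy p y m + condEntropy p z m -
      condEntropy p (fun ω => (x ω, y ω, z ω)) m ≤ entropy p m := by
  -- `s1` and `s2` remove `a` and `b` from the total entropy, keeping each only beside its own
  -- output and the message. `s3` and `s4` then cancel H(Θ₁) and H(Θ₂) at the price of one H(M)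
  -- each.
  have s1 := entropy_submodular hp.1 a (fun ω => (x ω, z ω)) (fun ω => (y ω, m ω))
  have s2 := entropy_submodular hp.1 b (fun ω => (x ω, y ω, a ω)) (fun ω => (z ω, m ω))
  have s3 := entropy_pair_le hp m a
  have s4 := entropy_pair_le hp m b
  have c1 : entropy p (fun ω => (a ω, (x ω, z ω), (y ω, m ω))) =
      entropy p (fun ω => ((x ω, y ω, a ω), (z ω, m ω))) :=
    entropy_congr p (by simp only [Prod.ext_iff]; tauto)
  have c2 : entropy p (fun ω => (a ω, (y ω, m ω))) = entropy p (fun ω => ((m ω, a ω), y ω)) :=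
    entropy_congr p (by simp only [Prod.ext_iff]; tauto)
  have c3 : entropy p (fun ω => ((x ω, z ω), (y ω, m ω))) =
      entropy p (fun ω => ((x ω, y ω, z ω), m ω)) :=
    entropy_congr p (by simp only [Prod.ext_iff]; tauto)
  have c4 : entropy p (fun ω => (b ω, (x ω, y ω, a ω), (z ω, m ω))) =
      entropy p (fun ω => (((((x ω, a ω), b ω), m ω), y ω), z ω)) :=
    entropy_congr p (by simp only [Prod.ext_iff]; tauto)
  have c5 : entropy p (fun ω => (b ω, (z ω, m ω))) = entropy p (fun ω => ((m ω, b ω), z ω)) :=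
    entropy_congr p (by simp only [Prod.ext_iff]; tauto)
  rw [c1, c2, c3] at s1
  rw [c4, c5] at s2
  simp only [condEntropy]
  linarith

/-- One-shot converse: `I(Y; Z | M) + I(M, Y, Z; X) ≤ H(M)` in a code. -/
lemma codePMF_infoSum_le (hP : P ∈ stdSimplex ℝ A) (h₁ : p₁ ∈ stdSimplex ℝ S)
    (h₂ : p₂ ∈ stdSimplex ℝ T) (he : ∀ x a b, e x a b ∈ stdSimplex ℝ M)
    (hd₁ : ∀ c a, d₁ c a ∈ stdSimplex ℝ B) (hd₂ : ∀ c b, d₂ c b ∈ stdSimplex ℝ C) :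
    entropy (codePMF P p₁ p₂ e d₁ d₂) (fun s => s.1.1.1.1.1) +
      condEntropy (codePMF P p₁ p₂ e d₁ d₂) (fun s => s.1.2) (fun s => s.1.1.2) +
      condEntropy (codePMF P p₁ p₂ e d₁ d₂) (fun s => s.2) (fun s => s.1.1.2) -
      condEntropy (codePMF P p₁ p₂ e d₁ d₂) (fun s => (s.1.1.1.1.1, s.1.2, s.2))
        (fun s => s.1.1.2) ≤
      entropy (codePMF P p₁ p₂ e d₁ d₂) (fun s => s.1.1.2) :=
  infoSum_le_entropy (codePMF_mem hP h₁ h₂ he hd₁ hd₂) _ (fun s => s.1.1.1.1.2)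
    (fun s => s.1.1.1.2) _ _ _ (codePMF_entropy_ge hP h₁ h₂ he hd₁ hd₂)

lemma law_codePMF :
    law (codePMF P p₁ p₂ e d₁ d₂) (fun s => (s.1.1.1.1.1, s.1.2, s.2)) = fun t =>
      P t.1 * ∑ a, ∑ b, p₁ a * p₂ b * ∑ c, e t.1 a b c * d₁ c a t.2.1 * d₂ c b t.2.2 := by
  classical
  ext ⟨x, y, z⟩
  simp only [law_apply, codePMF, sourcePMF, jointPMF, Fintype.sum_prod_type, Prod.mk.injEq]
  rw [Finset.sum_eq_single x (fun x' _ hx => by simp [hx]) (by simp)]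
  simp only [true_and, ite_and, Finset.mul_sum]
  refine Finset.sum_congr rfl fun a _ => Finset.sum_congr rfl fun b _ =>
    Finset.sum_congr rfl fun c _ => ?_
  rw [Finset.sum_eq_single y (fun y' _ hy => by simp [hy]) (by simp)]
  simp only [if_true, Finset.sum_ite_eq', Finset.mem_univ]
  ring

lemma entropy_codePMF_input (h₁ : p₁ ∈ stdSimplex ℝ S)
    (h₂ : p₂ ∈ stdSimplex ℝ T) (he : ∀ x a b, e x a b ∈ stdSimplex ℝ M)
    (hd₁ : ∀ c a, d₁ c a ∈ stdSimplex ℝ B) (hd₂ : ∀ c b, d₂ c b ∈ stdSimplex ℝ C) :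
    entropy (codePMF P p₁ p₂ e d₁ d₂) (fun s => s.1.1.1.1.1) = ∑ x, negMulLogb (P x) := by
  unfold codePMF sourcePMF
  have hd₂' : ∀ s : (((A × S) × T) × M) × B, d₂ s.1.2 s.1.1.2 ∈ stdSimplex ℝ C :=
    fun _ => hd₂ _ _
  have hd₁' : ∀ s : ((A × S) × T) × M, d₁ s.2 s.1.1.2 ∈ stdSimplex ℝ B := fun _ => hd₁ _ _
  have he' : ∀ s : (A × S) × T, e s.1.1 s.1.2 s.2 ∈ stdSimplex ℝ M := fun _ => he _ _ _
  rw [entropy_jointPMF_fst _ hd₂' fun s => s.1.1.1.1, entropy_jointPMF_fst _ hd₁' fun s => s.1.1.1,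
    entropy_jointPMF_fst _ he' fun s => s.1.1, entropy_jointPMF_fst _ (fun _ => h₂) Prod.fst,
    entropy_def]
  exact congrArg (fun r : A → ℝ => ∑ x, negMulLogb (r x)) (law_jointPMF_fst P fun _ => h₁)

end OneShot

open Filter Topology

/-! ### The asymptotic converse, and existence of an achievable rate. -/

section Converse

variable {X Y Z : Type*} [Fintype X] [Fintype Y] [Fintype Z] {qX : X → ℝ} {W : X → Y × Z → ℝ}

/-- The `i`-th letters of a triple of words. -/
def letters {n : ℕ} (i : Fin n) (t : (Fin n → X) × (Fin n → Y) × (Fin n → Z)) : X × Y × Z :=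
  (t.1 i, t.2.1 i, t.2.2 i)

/-- A triple of words is a word of triples. -/
def wordsEquiv (X Y Z : Type*) (n : ℕ) :
    (Fin n → X × Y × Z) ≃ (Fin n → X) × (Fin n → Y) × (Fin n → Z) where
  toFun v := (fun i => (v i).1, fun i => (v i).2.1, fun i => (v i).2.2)
  invFun t i := letters i t
  left_inv _ := rfl
  right_inv _ := rfl

lemma targetLaw_mem (hqX : qX ∈ stdSimplex ℝ X) (hW : ∀ x, W x ∈ stdSimplex ℝ (Y × Z)) (n : ℕ) :
    targetLaw n qX W ∈ stdSimplex ℝ ((Fin n → X) × (Fin n → Y) × (Fin n → Z)) := by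
  refine ⟨fun t => Finset.prod_nonneg fun i _ => mul_nonneg (hqX.1 _) ((hW _).1 _), ?_⟩
  rw [← Equiv.sum_comp (wordsEquiv X Y Z n)]
  exact sum_prod_eq_one (channelLaw_mem hqX hW).2

lemma sum_negMulLogb_targetLaw (hqX : qX ∈ stdSimplex ℝ X)
    (hW : ∀ x, W x ∈ stdSimplex ℝ (Y × Z)) (n : ℕ) :
    ∑ t, negMulLogb (targetLaw n qX W t) = n * ∑ t, negMulLogb (channelLaw qX W t) := by
  rw [← Equiv.sum_comp (wordsEquiv X Y Z n)]
  exact sum_negMulLogb_prod (channelLaw_mem hqX hW).2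

lemma law_targetLaw_letters (hqX : qX ∈ stdSimplex ℝ X)
    (hW : ∀ x, W x ∈ stdSimplex ℝ (Y × Z)) {n : ℕ} (i : Fin n) :
    law (targetLaw n qX W) (letters i) = channelLaw qX W := by
  classical
  ext t
  have h := sum_prod_mul_apply (channelLaw_mem hqX hW).2 (fun s => if s = t then 1 else 0) i
  rw [law_apply, ← Equiv.sum_comp (wordsEquiv X Y Z n)]
  simp only [mul_ite, mul_one, mul_zero, Finset.sum_ite_eq', Finset.mem_univ, if_true] at h
  exact h

lemma abs_law_sub_law_le {Ω α : Type*} [Fintype Ω] (p q : Ω → ℝ) (f : Ω → α) (a : α) :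
    |law p f a - law q f a| ≤ 2 * tvDist p q := by
  rw [law, law, ← Finset.sum_sub_distrib, tvDist, ← mul_assoc, mul_one_div_cancel two_ne_zero,
    one_mul]
  refine (Finset.abs_sum_le_sum_abs _ _).trans (Finset.sum_le_sum fun ω _ => ?_)
  split_ifs <;> simp

lemma uniform_mem {k : ℕ} (hk : 1 ≤ k) : (fun _ : Fin k => 1 / (k : ℝ)) ∈ stdSimplex ℝ (Fin k) := by
  refine ⟨fun _ => by positivity, ?_⟩
  have : (k : ℝ) ≠ 0 := by positivity
  simp [this]

/-- The joint law of the source, the shared randomness, the message and the outputs of a code. -/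
noncomputable def Code.fullLaw {n m k₁ k₂ : ℕ} (C : Code X Y Z n m k₁ k₂) (qX : X → ℝ) :
    (((((Fin n → X) × Fin k₁) × Fin k₂) × Fin m) × (Fin n → Y)) × (Fin n → Z) → ℝ :=
  codePMF (fun x => ∏ i, qX (x i)) (fun _ => 1 / (k₁ : ℝ)) (fun _ => 1 / (k₂ : ℝ)) C.enc C.dec₁
    C.dec₂

lemma Code.law_fullLaw {n m k₁ k₂ : ℕ} (C : Code X Y Z n m k₁ k₂) (qX : X → ℝ) :
    law (C.fullLaw qX) (fun s => (s.1.1.1.1.1, s.1.2, s.2)) = C.inducedLaw qX :=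
  law_codePMF

lemma prod_mem_stdSimplex (hqX : qX ∈ stdSimplex ℝ X) (n : ℕ) :
    (fun x : Fin n → X => ∏ i, qX (x i)) ∈ stdSimplex ℝ (Fin n → X) :=
  ⟨fun _ => Finset.prod_nonneg fun _ _ => hqX.1 _, sum_prod_eq_one hqX.2⟩

lemma Code.fullLaw_mem {n m k₁ k₂ : ℕ} (C : Code X Y Z n m k₁ k₂) (hqX : qX ∈ stdSimplex ℝ X)
    (hk₁ : 1 ≤ k₁) (hk₂ : 1 ≤ k₂) : C.fullLaw qX ∈ stdSimplex ℝ _ :=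
  codePMF_mem (prod_mem_stdSimplex hqX n) (uniform_mem hk₁) (uniform_mem hk₂) C.enc_mem C.dec₁_mem
    C.dec₂_mem

/-- Every code yields a point of `entropyRegion` near the law of the channel whose information
quantities are bounded by the rate of the code. -/
lemma Code.exists_mem_entropyRegion (hqX : qX ∈ stdSimplex ℝ X)
    (hW : ∀ x, W x ∈ stdSimplex ℝ (Y × Z)) [Nonempty X] [Nonempty Y] [Nonempty Z]
    {n m k₁ k₂ : ℕ} (C : Code X Y Z n m k₁ k₂) (hn : 1 ≤ n) (hm : 1 ≤ m) (hk₁ : 1 ≤ k₁)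
    (hk₂ : 1 ≤ k₂) {δ : ℝ} (hδ : tvDist (C.inducedLaw qX) (targetLaw n qX W) = δ) :
    ∃ s ∈ entropyRegion X Y Z, (∀ t, |s.1 t - channelLaw qX W t| ≤ 2 * δ) ∧
      n * (∑ x, negMulLogb (qX x) + s.2.1) ≤ Real.logb 2 m ∧
      n * (∑ t, negMulLogb (channelLaw qX W t) - s.2.2) ≤ Real.logb 2 m +
        entropyModulus δ + n * (δ * Real.logb 2 (Fintype.card (X × Y × Z))) := by
  have hp := C.fullLaw_mem hqX hk₁ hk₂
  have hI := C.law_fullLaw qX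
  have hIm := law_mem hp (fun s => (s.1.1.1.1.1, s.1.2, s.2))
  rw [hI] at hIm
  have hinfo := codePMF_infoSum_le (prod_mem_stdSimplex hqX n) (uniform_mem hk₁)
    (uniform_mem hk₂) C.enc_mem C.dec₁_mem C.dec₂_mem
  rw [entropy_codePMF_input (uniform_mem hk₁) (uniform_mem hk₂) C.enc_mem C.dec₁_mem C.dec₂_mem,
    sum_negMulLogb_prod hqX.2] at hinfo
  change _ * _ + condEntropy (C.fullLaw qX) _ _ + condEntropy (C.fullLaw qX) _ _ -
    condEntropy (C.fullLaw qX) _ _ ≤ entropy (C.fullLaw qX) _ at hinfo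
  have hout : ∑ t, negMulLogb (C.inducedLaw qX t) =
      entropy (C.fullLaw qX) (fun s => (s.1.1.1.1.1, s.1.2, s.2)) := by
    rw [entropy_def, hI]
  generalize C.fullLaw qX = p at hp hI hinfo hout
  have : Nonempty (Fin m) := ⟨⟨0, hm⟩⟩
  have hM := entropy_le_logb_card hp (fun s => s.1.1.2)
  rw [Fintype.card_fin] at hM
  obtain ⟨s, hs, hs1, hs2, hs3⟩ := BroadcastSim.exists_mem_entropyRegion hn hp
    (fun s => s.1.1.2) (fun s i => letters i (s.1.1.1.1.1, s.1.2, s.2))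
  have hn0 : (n : ℝ) ≠ 0 := by positivity
  have hV : condEntropy p (fun s i => letters i (s.1.1.1.1.1, s.1.2, s.2)) (fun s => s.1.1.2) =
      condEntropy p (fun s => (s.1.1.1.1.1, s.1.2, s.2)) (fun s => s.1.1.2) := by
    refine congrArg (· - _) (entropy_congr p fun ω ω' => ?_)
    simp only [letters, Prod.ext_iff, funext_iff, forall_and]
  rw [hV] at hs2 hs3
  refine ⟨s, hs, fun t => ?_, ?_, ?_⟩
  · have h1 : ∀ i, |law p (fun ω => letters i (ω.1.1.1.1.1, ω.1.2, ω.2)) t -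
        channelLaw qX W t| ≤ 2 * δ := by
      intro i
      have h2 := abs_law_sub_law_le (C.inducedLaw qX) (targetLaw n qX W) (letters i) t
      rwa [law_targetLaw_letters hqX hW, ← hI, law_law, hI, hδ] at h2
    have h3 : s.1 t - channelLaw qX W t = (n : ℝ)⁻¹ * ∑ i : Fin n,
        (law p (fun ω => letters i (ω.1.1.1.1.1, ω.1.2, ω.2)) t - channelLaw qX W t) := by
      rw [hs1, Finset.sum_sub_distrib]
      simp only [Pi.smul_apply, Finset.sum_apply, smul_eq_mul, Finset.sum_const, Finset.card_univ,
        Fintype.card_fin, nsmul_eq_mul]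
      field_simp
    rw [h3, abs_mul, abs_of_nonneg (by positivity), inv_mul_le_iff₀ (by positivity)]
    refine (Finset.abs_sum_le_sum_abs _ _).trans ((Finset.sum_le_sum fun i _ => h1 i).trans ?_)
    simp
  · rw [mul_add]
    refine le_trans ?_ (hinfo.trans hM)
    rw [add_assoc, add_sub_assoc]
    exact add_le_add_right hs2 _
  -- I(M;Vⁿ) ≤ H(M), with H(Vⁿ) under the code replaced by its ideal value through Fannes'
  -- inequality. The preceding bound needs no such correction, because the input of the code is
  -- exactly i.i.d.
  · have hF := sum_negMulLogb_le_of_tvDist hIm (targetLaw_mem hqX hW n)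
    have hcard : Real.logb 2 (Fintype.card ((Fin n → X) × (Fin n → Y) × (Fin n → Z))) =
        n * Real.logb 2 (Fintype.card (X × Y × Z)) := by
      rw [← Fintype.card_congr (wordsEquiv X Y Z n), Fintype.card_fun, Fintype.card_fin,
        Nat.cast_pow, Real.logb_pow]
    rw [sum_negMulLogb_targetLaw hqX hW, hδ, hcard, hout] at hF
    have hmono := entropy_mono hp.1 (f := fun s => (s.1.1.1.1.1, s.1.2, s.2))
      (g := fun s => ((s.1.1.1.1.1, s.1.2, s.2), s.1.1.2)) fun _ _ h => (Prod.mk.inj h).1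
    rw [mul_sub, hs3, condEntropy]
    linarith

/-- Codes with error below 1/(j+1) give points of a compact region; a cluster point lies over the
channel law and inherits both bounds. -/
lemma Achievable.exists_le (hqX : qX ∈ stdSimplex ℝ X) (hW : ∀ x, W x ∈ stdSimplex ℝ (Y × Z))
    [Nonempty X] [Nonempty Y] [Nonempty Z] {R R₁ R₂ : ℝ} (h : Achievable qX W R R₁ R₂) :
    ∃ c ∈ attainablePairs qX W, c.1 ≤ R ∧ c.2 ≤ R := by
  obtain ⟨hR, hR₁, hR₂, h⟩ := h
  set q := channelLaw qX W
  have key : ∀ j : ℕ, ∃ δ : ℝ, ∃ s ∈ entropyRegion X Y Z, 0 ≤ δ ∧ δ ≤ 1 / ((j : ℝ) + 1) ∧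
      (∀ t, |s.1 t - q t| ≤ 2 * δ) ∧ ∑ x, negMulLogb (qX x) + s.2.1 ≤ R ∧
      ∑ t, negMulLogb (q t) - s.2.2 ≤
        R + (entropyModulus δ + δ * Real.logb 2 (Fintype.card (X × Y × Z))) := by
    intro j
    obtain ⟨n, hn, C, hC⟩ := h (1 / ((j : ℝ) + 1)) (by positivity)
    have hfloor : ∀ r : ℝ, 0 ≤ r → 1 ≤ ⌊(2 : ℝ) ^ ((n : ℝ) * r)⌋₊ := by
      intro r hr
      exact Nat.le_floor (by simpa using Real.one_le_rpow one_le_two (by positivity))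
    obtain ⟨s, hs, hs1, hs2, hs3⟩ := C.exists_mem_entropyRegion hqX hW hn (hfloor R hR)
      (hfloor R₁ hR₁) (hfloor R₂ hR₂) rfl
    have hm : Real.logb 2 (⌊(2 : ℝ) ^ ((n : ℝ) * R)⌋₊ : ℝ) ≤ n * R := by
      rw [Real.logb_le_iff_le_rpow one_lt_two (by exact_mod_cast hfloor R hR)]
      exact Nat.floor_le (by positivity)
    have hn0 : (0 : ℝ) < n := by positivity
    have hn1 : (1 : ℝ) ≤ n := by exact_mod_cast hn
    have hp := C.fullLaw_mem hqX (hfloor R₁ hR₁) (hfloor R₂ hR₂)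
    have hI := law_mem hp (fun s => (s.1.1.1.1.1, s.1.2, s.2))
    rw [C.law_fullLaw] at hI
    have h0 := tvDist_nonneg (C.inducedLaw qX) (targetLaw n qX W)
    have hmod := entropyModulus_nonneg h0 (tvDist_le_one hI (targetLaw_mem hqX hW n))
    refine ⟨_, s, hs, h0, hC.le, hs1, ?_, ?_⟩
    · exact le_of_mul_le_mul_left (hs2.trans hm) hn0
    · refine le_of_mul_le_mul_left (hs3.trans ?_) hn0
      -- Blocklengths need not grow with `j`, so the modulus is only bounded by `n` times itself; it
      -- disappears because δ tends to 0.
      have := mul_le_mul_of_nonneg_right hn1 hmod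
      linarith
  choose δ s hs hδ0 hδ1 hs1 hs2 hs3 using key
  have hδ : Tendsto δ atTop (𝓝 0) :=
    squeeze_zero hδ0 hδ1 tendsto_one_div_add_atTop_nhds_zero_nat
  obtain ⟨a, ha, φ, hφ, hlim⟩ := isCompact_entropyRegion.tendsto_subseq hs
  have hδφ := hδ.comp hφ.tendsto_atTop
  have ha1 : a.1 = q := by
    ext t
    have l1 : Tendsto (fun j => |(s (φ j)).1 t - q t|) atTop (𝓝 |a.1 t - q t|) :=
      (((continuous_apply t).comp continuous_fst).sub continuous_const).abs.continuousAt.tendsto.comp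
        hlim
    have l2 : Tendsto (fun j => 2 * δ (φ j)) atTop (𝓝 (2 * 0)) := hδφ.const_mul 2
    have := le_of_tendsto_of_tendsto' l1 l2 fun j => hs1 (φ j) t
    rw [mul_zero, abs_nonpos_iff, sub_eq_zero] at this
    exact this
  have ha2 : ∑ x, negMulLogb (qX x) + a.2.1 ≤ R := by
    have l1 : Tendsto (fun j => ∑ x, negMulLogb (qX x) + (s (φ j)).2.1) atTop
        (𝓝 (∑ x, negMulLogb (qX x) + a.2.1)) :=
      (continuous_const.add (continuous_fst.comp continuous_snd)).continuousAt.tendsto.comp hlim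
    exact le_of_tendsto' l1 fun j => hs2 (φ j)
  have ha3 : ∑ t, negMulLogb (q t) - a.2.2 ≤ R := by
    have l1 : Tendsto (fun j => ∑ t, negMulLogb (q t) - (s (φ j)).2.2) atTop
        (𝓝 (∑ t, negMulLogb (q t) - a.2.2)) :=
      (continuous_const.sub (continuous_snd.comp continuous_snd)).continuousAt.tendsto.comp hlim
    have hc : Continuous fun d : ℝ =>
        R + (entropyModulus d + d * Real.logb 2 (Fintype.card (X × Y × Z))) := by
      have := continuous_entropyModulus
      fun_prop
    have l2 := (hc.tendsto 0).comp hδφ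
    have h0 : entropyModulus 0 = 0 := by simp [entropyModulus]
    rw [h0, zero_mul, add_zero, add_zero] at l2
    exact le_of_tendsto_of_tendsto' l1 l2 fun j => hs3 (φ j)
  refine ⟨(_, _), (mem_attainablePairs_iff hqX hW _).2 ?_, ha2, ha3⟩
  convert ha using 1
  exact Prod.ext ha1.symm (Prod.ext (add_sub_cancel_left _ _) (sub_sub_cancel _ _))

/-- The code in which the message determines both outputs. -/
noncomputable def directCode (W : X → Y × Z → ℝ) (hW : ∀ x, W x ∈ stdSimplex ℝ (Y × Z))
    {m : ℕ} (k₁ k₂ : ℕ) (e : Fin m ≃ Y × Z) : Code X Y Z 1 m k₁ k₂ :=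
  open scoped Classical in
  { enc := fun x _ _ c => W (x 0) (e c)
    enc_mem := fun x _ _ => ⟨fun _ => (hW _).1 _, by rw [Equiv.sum_comp e, (hW _).2]⟩
    dec₁ := fun c _ => Pi.single (fun _ => (e c).1) 1
    dec₁_mem := fun _ _ => single_mem_stdSimplex ℝ _
    dec₂ := fun c _ => Pi.single (fun _ => (e c).2) 1
    dec₂_mem := fun _ _ => single_mem_stdSimplex ℝ _ }

lemma inducedLaw_directCode (hW : ∀ x, W x ∈ stdSimplex ℝ (Y × Z)) {m k₁ k₂ : ℕ} (hk₁ : 1 ≤ k₁)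
    (hk₂ : 1 ≤ k₂) (e : Fin m ≃ Y × Z) :
    (directCode W hW k₁ k₂ e).inducedLaw qX = targetLaw 1 qX W := by
  classical
  ext ⟨x, y, z⟩
  have h1 : (k₁ : ℝ) ≠ 0 := by positivity
  have h2 : (k₂ : ℝ) ≠ 0 := by positivity
  have h3 : ∑ c, W (x 0) (e c) * (Pi.single (fun _ : Fin 1 => (e c).1) (1 : ℝ) : _ → ℝ) y *
      (Pi.single (fun _ : Fin 1 => (e c).2) (1 : ℝ) : _ → ℝ) z = W (x 0) (y 0, z 0) := by
    rw [Equiv.sum_comp e (fun t : Y × Z => W (x 0) t *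
      (Pi.single (fun _ : Fin 1 => t.1) (1 : ℝ) : _ → ℝ) y *
      (Pi.single (fun _ : Fin 1 => t.2) (1 : ℝ) : _ → ℝ) z),
      Finset.sum_eq_single (y 0, z 0)]
    · have hy : y = fun _ => y 0 := funext fun i => by rw [Subsingleton.elim i 0]
      have hz : z = fun _ => z 0 := funext fun i => by rw [Subsingleton.elim i 0]
      rw [← hy, ← hz]
      simp
    · rintro ⟨b, c⟩ - hne
      by_cases hb : y = fun _ => b
      · have hc : z ≠ fun _ => c := by
          rintro rfl
          exact hne (by rw [hb])
        simp [Pi.single_eq_of_ne hc]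
      · simp [Pi.single_eq_of_ne hb]
    · simp
  have h4 : ∀ (a : Fin k₁) (b : Fin k₂), ∑ c, (directCode W hW k₁ k₂ e).enc x a b c *
      (directCode W hW k₁ k₂ e).dec₁ c a y * (directCode W hW k₁ k₂ e).dec₂ c b z =
        W (x 0) (y 0, z 0) := by
    intro a b
    rw [← h3]
    unfold directCode
    dsimp only
  simp only [Code.inducedLaw, targetLaw, h4, Finset.sum_const, Finset.card_univ, Fintype.card_fin,
    nsmul_eq_mul, Fin.prod_univ_one]
  field_simp

/-- The infimum defining `Ropt` must range over a nonempty set. Drawing both outputs at the encoder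
and sending them is exact at blocklength 1 and needs no shared randomness. -/
lemma exists_achievable (hW : ∀ x, W x ∈ stdSimplex ℝ (Y × Z)) [Nonempty Y] [Nonempty Z] :
    ∃ R R₁ R₂, Achievable qX W R R₁ R₂ := by
  have hN : (1 : ℝ) ≤ Fintype.card (Y × Z) := by exact_mod_cast Fintype.card_pos
  refine ⟨Real.logb 2 (Fintype.card (Y × Z)), 0, 0, Real.logb_nonneg one_lt_two hN, le_rfl, le_rfl,
    fun ε hε => ⟨1, le_rfl, ?_⟩⟩
  have hm : ⌊(2 : ℝ) ^ (((1 : ℕ) : ℝ) * Real.logb 2 (Fintype.card (Y × Z)))⌋₊ =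
      Fintype.card (Y × Z) := by
    rw [Nat.cast_one, one_mul, Real.rpow_logb two_pos (by norm_num) (by linarith),
      Nat.floor_natCast]
  refine ⟨directCode W hW _ _ ((finCongr hm).trans (Fintype.equivFin (Y × Z)).symm), ?_⟩
  rw [inducedLaw_directCode hW (by simp) (by simp)]
  simpa [tvDist] using hε

end Converse

end BroadcastSim

theorem mainTheorem2 {X Y Z : Type*} [Fintype X] [Fintype Y] [Fintype Z]
    (qX : X → ℝ) (hqX : qX ∈ stdSimplex ℝ X)
    (W : X → Y × Z → ℝ) (hW : ∀ x, W x ∈ stdSimplex ℝ (Y × Z)) :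
    ∃ v : ℝ,
      IsLeast {r : ℝ | ∃ k : ℕ, ∃ pU ∈ BroadcastSim.auxChannels X Y Z k,
        r = max (BroadcastSim.infoSum qX W pU)
          ((1 / 2) * (BroadcastSim.infoSum qX W pU + BroadcastSim.infoAux qX W pU))} v ∧
      IsLeast {r : ℝ | ∃ k : ℕ, ∃ pU ∈ BroadcastSim.auxChannels X Y Z k,
        r = max (BroadcastSim.infoSum qX W pU) (BroadcastSim.infoAux qX W pU)} v ∧
      v ≤ BroadcastSim.Ropt qX W := by
  obtain ⟨v, hv1, hv2⟩ := BroadcastSim.exists_isLeast_attainablePairs hqX hW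
  have himage : ∀ F : ℝ × ℝ → ℝ, F '' BroadcastSim.attainablePairs qX W =
      {r : ℝ | ∃ k : ℕ, ∃ pU ∈ BroadcastSim.auxChannels X Y Z k,
        r = F (BroadcastSim.infoSum qX W pU, BroadcastSim.infoAux qX W pU)} := by
    intro F
    ext r
    constructor
    · rintro ⟨_, ⟨k, pU, hpU, h1, h2⟩, rfl⟩
      exact ⟨k, pU, hpU, by rw [h1, h2]⟩
    · rintro ⟨k, pU, hpU, rfl⟩
      exact ⟨_, ⟨k, pU, hpU, rfl, rfl⟩, rfl⟩
  have hX : Nonempty X := by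
    by_contra h
    rw [not_nonempty_iff] at h
    simpa using hqX.2
  have hYZ : Nonempty (Y × Z) := by
    by_contra h
    rw [not_nonempty_iff] at h
    simpa using (hW hX.some).2
  have hY : Nonempty Y := ⟨hYZ.some.1⟩
  have hZ : Nonempty Z := ⟨hYZ.some.2⟩
  refine ⟨v, ?_, ?_, ?_⟩
  · rw [himage] at hv1
    exact hv1
  · rw [himage] at hv2
    exact hv2
  · refine le_csInf (BroadcastSim.exists_achievable hW) ?_
    rintro R ⟨R₁, R₂, hR⟩
    obtain ⟨c, hc, h1, h2⟩ := hR.exists_le hqX hW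
    -- The converse bounds both coordinates by `R`, so it meets the second form of the minimum
    -- directly; the first follows because the two values coincide.
    exact (hv2.2 (Set.mem_image_of_mem _ hc)).trans (max_le h1 h2)
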